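/- For graphs $H$ and $G$ let $\mathcal N(H,G)$ denote the number of (unlabelled, not necessarily induced) copies of $H$ in $G$, i.e. the number of subgraphs of $G$ isomorphic to $H$, and let $\mathrm{ex}(n,H,F)$ denote the maximum of $\mathcal N(H,G)$ over all $n$-vertex graphs $G$ that contain no subgraph isomorphic to $F$. Let $K_{a,b}$ be the complete bipartite graph with parts of sizes $a$ and $b$, let $kG$ denote $k$ vertex-disjoint copies of $G$, and let $G+G'$ denote the vertex-disjoint union of $G$ and $G'$. Throughout, $n\ge 0$ and $a,b,s,t\ge 1$ are integers. (i) If $a<b<t$, then for every $n$ $$\mathrm{ex}(n,K_{a,b},K_{1,t})\le \frac{n}{a+b}\left(\binom{t-1}{a}\binom{t-1}{b-1}+\binom{t-1}{b}\binom{t-1}{a-1}\right),$$ and if $a<t$, then for every $n$ $$\mathrm{ex}(n,K_{a,a},K_{1,t})\le \frac{n}{2a}\binom{t-1}{a}\binom{t-1}{a-1}.$$ Moreover, if $a\le b<t$ and $2t-2$ divides $n$, then $$\mathrm{ex}(n,K_{a,b},K_{1,t})=\mathcal N\left(K_{a,b},\tfrac{n}{2t-2}K_{t-1,t-1}\right).$$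 (ii) If $a<t\le \frac{8a}{7}+1$, then for every $n$ $$\mathrm{ex}(n,K_{a,a},K_{1,t})=\mathcal N\left(K_{a,a},\left\lfloor \tfrac{n}{2t-2}\right\rfloor K_{t-1,t-1}+K_{\lfloor p/2\rfloor,\lceil p/2\rceil}\right),\qquad p=n-(2t-2)\left\lfloor \tfrac{n}{2t-2}\right\rfloor .$$ (iii) If $2\le s<a\le b<t$, then $\mathrm{ex}(n,K_{a,b},K_{s,t})=\Omega\left(n^{3/2-o(1)}\right)$ as $n\to\infty$ with $a,b,s,t$ fixed; that is, there are a function $\varepsilon(n)\to 0$ and a constant $c>0$, both depending only on $a,b,s,t$, such that $\mathrm{ex}(n,K_{a,b},K_{s,t})\ge c\,n^{3/2-\varepsilon(n)}$ for all sufficiently large $n$. -/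

import Mathlib

open Filter Topology Asymptotics

/-- The complete bipartite graph `K_{a,b}` with parts of sizes `a` and `b`. -/
abbrev Kab (a b : ℕ) : SimpleGraph (Fin a ⊕ Fin b) :=
  completeBipartiteGraph (Fin a) (Fin b)

/-- `k` vertex-disjoint copies of the graph `G`. -/
def disjointCopies (k : ℕ) {V : Type*} (G : SimpleGraph V) : SimpleGraph (Fin k × V) where
  Adj x y := x.1 = y.1 ∧ G.Adj x.2 y.2
  symm := ⟨fun _ _ h => ⟨h.1.symm, h.2.symm⟩⟩
  loopless := ⟨fun _ h => h.2.ne rfl⟩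

open scoped Classical in
/-- The generalized Turán number `ex(n, H, F)`: the maximum number of (unlabelled, not necessarily
induced) copies of `H` in an `F`-free graph on `n` vertices. -/
noncomputable def genEx (n : ℕ) {V W : Type*} (H : SimpleGraph V) (F : SimpleGraph W) : ℕ :=
  Finset.sup {G : SimpleGraph (Fin n) | F.Free G} (fun G => G.copyCount H)

/-! Copies of K_{a,b} are counted as ordered pairs (A, B) of vertex sets joined completely; such a
pair is determined by its copy up to the swap when a = b, whence the factor 2 in `copyCount_Kab`. A
graph is K_{1,t}-free exactly when all degrees are at most D = t - 1.

Part (i). Count triples (v, A, B) with v ∈ A: B lies in N(v), and for any y ∈ B the rest of A lies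
in N(y) \ {v}. This gives D · #pairs ≤ n · C(D,a) · C(D,b), with equality for disjoint copies of
K_{D,D}. The closed bounds are weakenings of it.

Part (ii). When 7D ≤ 8a, two pairs whose first sets meet have |B ∪ B'| ≤ D, so |B ∩ B'| ≥ 2a - D ≥
6a/7, and then the same holds for the first sets. Hence meeting is an equivalence relation. The
unions X and Y of the two sides of a class are disjoint, and every pair outside the class and its
swap avoids X ∪ Y. So classes can be removed one at a time (`card_bicliques_le_packedCount`). A
class with |X| ≤ D or |Y| ≤ D has no more pairs than a balanced complete bipartite graph allows; if
both are larger, `card_family_le_of_lt` still bounds it by C(D,a)². Convexity of the balanced count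
makes the contributions superadditive (`packedCount_add_le`).

Part (iii). Over a field F with q elements take a left and b right copies of F², and a set M of size
q^{1-o(1)} of Behrend type. Each x ∈ F² and m ∈ M give the progression x + k(m, m²), 0 ≤ k < a + b,
whose terms span a K_{a,b}: in total q²|M| pairs on (a+b)q² vertices. Two vertices on one side have
at most one common neighbour in each opposite class (`ConvexFree.eq_of_moment_eq`), hence at most b
< t in all, so the graph has no K_{2,t}. -/

/-! ### Copies of K_{a,b} as ordered pairs of vertex sets. -/

section Bicliques
open scoped Classical
open Finset

variable {V W : Type*}

/-- The pairs `(A, B)` of subsets of `S`, of sizes `a` and `b`, with all edges of `G` between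
`A` and `B`. -/
noncomputable def bicliques (G : SimpleGraph V) (S : Finset V) (a b : ℕ) :
    Finset (Finset V × Finset V) :=
  {P ∈ powersetCard a S ×ˢ powersetCard b S | ∀ x ∈ P.1, ∀ y ∈ P.2, G.Adj x y}

theorem mem_bicliques {G : SimpleGraph V} {S : Finset V} {a b : ℕ} {P : Finset V × Finset V} :
    P ∈ bicliques G S a b ↔ ((P.1 ⊆ S ∧ #P.1 = a) ∧ P.2 ⊆ S ∧ #P.2 = b) ∧
      ∀ x ∈ P.1, ∀ y ∈ P.2, G.Adj x y := by
  simp [bicliques, mem_powersetCard]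

theorem swap_mem_bicliques {G : SimpleGraph V} {S : Finset V} {a b : ℕ}
    {P : Finset V × Finset V} (h : P ∈ bicliques G S a b) : P.swap ∈ bicliques G S b a := by
  rw [mem_bicliques] at h ⊢
  exact ⟨⟨h.1.2, h.1.1⟩, fun x hx y hy => (h.2 y hy x hx).symm⟩

/-- The subgraph of `G` formed by the edges between `A` and `B`. -/
def bicliqueSubgraph (G : SimpleGraph V) (P : Finset V × Finset V) : G.Subgraph where
  verts := {x | x ∈ P.1 ∨ x ∈ P.2}
  Adj x y := G.Adj x y ∧ ((x ∈ P.1 ∧ y ∈ P.2) ∨ (x ∈ P.2 ∧ y ∈ P.1))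
  adj_sub h := h.1
  edge_vert h := h.2.elim (fun h => Or.inl h.1) (fun h => Or.inr h.1)
  symm := ⟨fun _ _ h => ⟨h.1.symm, h.2.elim (fun h => Or.inr ⟨h.2, h.1⟩)
    (fun h => Or.inl ⟨h.2, h.1⟩)⟩⟩

theorem bicliqueSubgraph_swap (G : SimpleGraph V) (P : Finset V × Finset V) :
    bicliqueSubgraph G P.swap = bicliqueSubgraph G P := by
  ext x y
  · simp [bicliqueSubgraph, or_comm]
  · simp [bicliqueSubgraph, or_comm]

theorem toSubgraph_copy_Kab {G : SimpleGraph V} {a b : ℕ} (f : SimpleGraph.Copy (Kab a b) G) :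
    f.toSubgraph = bicliqueSubgraph G
      (univ.image fun i => f (Sum.inl i), univ.image fun j => f (Sum.inr j)) := by
  ext x y
  · simp [bicliqueSubgraph]
  · simp only [SimpleGraph.Copy.toSubgraph, SimpleGraph.Subgraph.map_adj, Relation.Map,
      SimpleGraph.Subgraph.top_adj, SimpleGraph.Copy.toHom_apply, bicliqueSubgraph, mem_image,
      mem_univ, true_and]
    constructor
    · rintro ⟨u, v, huv, rfl, rfl⟩
      refine ⟨f.toHom.map_rel huv, ?_⟩
      rcases u with i | i <;> rcases v with j | j <;> simp at huv ⊢
    · rintro ⟨-, ⟨⟨i, rfl⟩, j, rfl⟩ | ⟨⟨i, rfl⟩, j, rfl⟩⟩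
      · exact ⟨.inl i, .inr j, by simp, rfl, rfl⟩
      · exact ⟨.inr i, .inl j, by simp, rfl, rfl⟩

theorem copy_Kab_mem_bicliques [Fintype V] {G : SimpleGraph V} {a b : ℕ}
    (f : SimpleGraph.Copy (Kab a b) G) :
    ((univ.image fun i => f (Sum.inl i), univ.image fun j => f (Sum.inr j)) :
      Finset V × Finset V) ∈ bicliques G univ a b := by
  rw [mem_bicliques]
  refine ⟨⟨⟨subset_univ _, ?_⟩, subset_univ _, ?_⟩, ?_⟩
  · exact (card_image_of_injective _
      (fun i j h => Sum.inl_injective (f.injective h))).trans (by simp)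
  · exact (card_image_of_injective _
      (fun i j h => Sum.inr_injective (f.injective h))).trans (by simp)
  · simp only [mem_image, mem_univ, true_and]
    rintro _ ⟨i, rfl⟩ _ ⟨j, rfl⟩
    exact f.toHom.map_rel (by simp)

theorem exists_copy_of_mem_bicliques {G : SimpleGraph V} {S : Finset V} {a b : ℕ}
    {P : Finset V × Finset V} (h : P ∈ bicliques G S a b) :
    ∃ f : SimpleGraph.Copy (Kab a b) G, (univ.image fun i => f (Sum.inl i)) = P.1 ∧
      (univ.image fun j => f (Sum.inr j)) = P.2 := by
  rw [mem_bicliques] at h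
  obtain ⟨⟨⟨-, hA⟩, -, hB⟩, hadj⟩ := h
  let e := (P.1.equivFinOfCardEq hA).symm
  let e' := (P.2.equivFinOfCardEq hB).symm
  refine ⟨⟨⟨Sum.elim (fun i => (e i : V)) (fun j => (e' j : V)), ?_⟩, ?_⟩, ?_, ?_⟩
  · rintro (i | i) (j | j) hij <;> simp at hij ⊢
    · exact hadj _ (e i).2 _ (e' j).2
    · exact (hadj _ (e j).2 _ (e' i).2).symm
  · rintro (i | i) (j | j) hij <;> simp at hij ⊢
    · exact hij
    · exact (hadj _ (e i).2 _ (e' j).2).ne hij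
    · exact (hadj _ (e j).2 _ (e' i).2).ne hij.symm
    · exact hij
  · ext x
    refine ⟨fun hx => ?_, fun hx => mem_image.2 ⟨e.symm ⟨x, hx⟩, mem_univ _, ?_⟩⟩
    · obtain ⟨i, -, rfl⟩ := mem_image.1 hx
      exact (e i).2
    · change ((e (e.symm ⟨x, hx⟩) : P.1) : V) = x
      rw [Equiv.apply_symm_apply]
  · ext x
    refine ⟨fun hx => ?_, fun hx => mem_image.2 ⟨e'.symm ⟨x, hx⟩, mem_univ _, ?_⟩⟩
    · obtain ⟨i, -, rfl⟩ := mem_image.1 hx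
      exact (e' i).2
    · change ((e' (e'.symm ⟨x, hx⟩) : P.2) : V) = x
      rw [Equiv.apply_symm_apply]

theorem bicliqueSubgraph_adj {G : SimpleGraph V} {S : Finset V} {a b : ℕ}
    {P : Finset V × Finset V} (h : P ∈ bicliques G S a b) {x y : V} (hx : x ∈ P.1) :
    (bicliqueSubgraph G P).Adj x y ↔ y ∈ P.2 := by
  rw [mem_bicliques] at h
  constructor
  · rintro ⟨-, ⟨-, hy⟩ | ⟨hx', -⟩⟩
    · exact hy
    · exact absurd rfl (h.2 x hx x hx').ne
  · intro hy
    exact ⟨h.2 x hx y hy, Or.inl ⟨hx, hy⟩⟩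

/-- In the subgraph the neighbourhood of a point of the first set is exactly the second set, and
conversely. One point whose side is known therefore recovers both sets. -/
theorem eq_of_bicliqueSubgraph_eq {G : SimpleGraph V} {S T : Finset V} {a b c d : ℕ}
    {P Q : Finset V × Finset V} (hP : P ∈ bicliques G S a b) (hQ : Q ∈ bicliques G T c d)
    (h : bicliqueSubgraph G P = bicliqueSubgraph G Q) {x y : V} (hx : x ∈ P.1) (hx' : x ∈ Q.1)
    (hy : y ∈ P.2) : P = Q := by
  have h2 : P.2 = Q.2 := by
    ext z
    rw [← bicliqueSubgraph_adj hP hx, h, bicliqueSubgraph_adj hQ hx']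
  refine Prod.ext ?_ h2
  ext z
  have hy1 : y ∈ P.swap.1 := hy
  have hy2 : y ∈ Q.swap.1 := by
    change y ∈ Q.2
    rw [← h2]; exact hy
  change z ∈ P.swap.2 ↔ z ∈ Q.swap.2
  rw [← bicliqueSubgraph_adj (swap_mem_bicliques hP) hy1,
    ← bicliqueSubgraph_adj (swap_mem_bicliques hQ) hy2, bicliqueSubgraph_swap,
    bicliqueSubgraph_swap, h]

theorem eq_or_eq_swap_of_bicliqueSubgraph_eq {G : SimpleGraph V} {S T : Finset V} {a b c d : ℕ}
    {P Q : Finset V × Finset V} (ha : 1 ≤ a) (hb : 1 ≤ b) (hP : P ∈ bicliques G S a b)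
    (hQ : Q ∈ bicliques G T c d) (h : bicliqueSubgraph G P = bicliqueSubgraph G Q) :
    P = Q ∨ P = Q.swap := by
  have hP' := mem_bicliques.1 hP
  obtain ⟨x, hx⟩ : P.1.Nonempty := card_pos.1 (by omega)
  obtain ⟨y, hy⟩ : P.2.Nonempty := card_pos.1 (by omega)
  have hxQ : x ∈ (bicliqueSubgraph G Q).verts := h ▸ Or.inl hx
  rcases hxQ with hxQ | hxQ
  · exact Or.inl (eq_of_bicliqueSubgraph_eq hP hQ h hx hxQ hy)
  · exact Or.inr (eq_of_bicliqueSubgraph_eq hP (swap_mem_bicliques hQ)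
      (h.trans (bicliqueSubgraph_swap G Q).symm) hx hxQ hy)

/-- Each copy of `K_{a,b}` is counted once by the bicliques if `a ≠ b` and twice if `a = b`. -/
theorem copyCount_Kab [Fintype V] (G : SimpleGraph V) {a b : ℕ} (ha : 1 ≤ a) (hb : 1 ≤ b) :
    G.copyCount (Kab a b) * (if a = b then 2 else 1) = #(bicliques G univ a b) := by
  have hrange : ∀ S : G.Subgraph, Nonempty (Kab a b ≃g S.coe) ↔
      ∃ f : SimpleGraph.Copy (Kab a b) G, f.toSubgraph = S := by
    intro S
    exact (Set.ext_iff.1 (SimpleGraph.Copy.range_toSubgraph (A := Kab a b) (B := G)) S).symm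
  have hmaps : Set.MapsTo (bicliqueSubgraph G) (bicliques G univ a b : Set _)
      (({S : G.Subgraph | Nonempty (Kab a b ≃g S.coe)} : Finset _) : Set G.Subgraph) := by
    intro P hP
    obtain ⟨f, h1, h2⟩ := exists_copy_of_mem_bicliques (mem_coe.1 hP)
    simp only [coe_filter, mem_univ, true_and, Set.mem_ofPred_eq]
    rw [hrange]
    refine ⟨f, ?_⟩
    rw [toSubgraph_copy_Kab, h1, h2]
  rw [card_eq_sum_card_fiberwise hmaps, sum_const_nat (m := if a = b then 2 else 1)]
  · unfold SimpleGraph.copyCount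
    congr!
  · intro S hS
    simp only [mem_filter, mem_univ, true_and] at hS
    rw [hrange] at hS
    obtain ⟨f, rfl⟩ := hS
    rw [toSubgraph_copy_Kab]
    have hQ := copy_Kab_mem_bicliques f
    set Q : Finset V × Finset V :=
      (univ.image fun i => f (Sum.inl i), univ.image fun j => f (Sum.inr j)) with hQdef
    have hQ' := mem_bicliques.1 hQ
    split_ifs with hab
    · subst hab
      have : ({P ∈ bicliques G univ a a | bicliqueSubgraph G P = bicliqueSubgraph G Q})
          = {Q, Q.swap} := by
        ext P
        simp only [mem_filter, mem_insert, mem_singleton]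
        constructor
        · rintro ⟨hP, h⟩
          exact eq_or_eq_swap_of_bicliqueSubgraph_eq ha hb hP hQ h
        · rintro (rfl | rfl)
          · exact ⟨hQ, rfl⟩
          · exact ⟨swap_mem_bicliques hQ, bicliqueSubgraph_swap G Q⟩
      rw [this, card_pair]
      intro h
      obtain ⟨x, hx⟩ : Q.1.Nonempty := card_pos.1 (by omega)
      have h1 : Q.1 = Q.2 := congrArg Prod.fst h
      exact absurd rfl (hQ'.2 x hx x (h1 ▸ hx)).ne
    · have : ({P ∈ bicliques G univ a b | bicliqueSubgraph G P = bicliqueSubgraph G Q})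
          = {Q} := by
        ext P
        simp only [mem_filter, mem_singleton]
        constructor
        · rintro ⟨hP, h⟩
          rcases eq_or_eq_swap_of_bicliqueSubgraph_eq ha hb hP hQ h with h | h
          · exact h
          · have hP' := mem_bicliques.1 hP
            rw [h] at hP'
            simp only [Prod.fst_swap, Prod.snd_swap] at hP'
            omega
        · rintro rfl
          exact ⟨hQ, rfl⟩
      rw [this, card_singleton]

theorem map_mem_bicliques [Fintype V] [Fintype W] {G : SimpleGraph V} {H : SimpleGraph W}
    (f : SimpleGraph.Copy G H) {a b : ℕ} {P : Finset V × Finset V}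
    (hP : P ∈ bicliques G univ a b) :
    (P.1.map f.toEmbedding, P.2.map f.toEmbedding) ∈ bicliques H univ a b := by
  have hP' := mem_bicliques.1 hP
  refine mem_bicliques.2 ⟨⟨⟨subset_univ _, ?_⟩, subset_univ _, ?_⟩, ?_⟩
  · simpa using hP'.1.1.2
  · simpa using hP'.1.2.2
  · simp only [Finset.mem_map]
    rintro _ ⟨x, hx, rfl⟩ _ ⟨y, hy, rfl⟩
    exact f.toHom.map_rel (hP'.2 x hx y hy)

theorem card_bicliques_map_le [Fintype V] [Fintype W] {G : SimpleGraph V} {H : SimpleGraph W}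
    (f : SimpleGraph.Copy G H) (a b : ℕ) :
    #(bicliques G univ a b) ≤ #(bicliques H univ a b) := by
  refine card_le_card_of_injOn (fun P => (P.1.map f.toEmbedding, P.2.map f.toEmbedding))
    (fun P hP => map_mem_bicliques f hP) ?_
  exact ((Finset.map_injective _).prodMap (Finset.map_injective _)).injOn

theorem copyCount_Kab_mono [Fintype V] [Fintype W] {G : SimpleGraph V} {H : SimpleGraph W}
    {a b : ℕ} (ha : 1 ≤ a) (hb : 1 ≤ b)
    (h : #(bicliques G univ a b) ≤ #(bicliques H univ a b)) :
    G.copyCount (Kab a b) ≤ H.copyCount (Kab a b) := by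
  rw [← copyCount_Kab G ha hb, ← copyCount_Kab H ha hb] at h
  exact Nat.le_of_mul_le_mul_right h (by split_ifs <;> norm_num)

theorem genEx_le {n c : ℕ} {X Y : Type*} {H : SimpleGraph X} {F : SimpleGraph Y}
    (h : ∀ G : SimpleGraph (Fin n), F.Free G → G.copyCount H ≤ c) : genEx n H F ≤ c := by
  unfold genEx
  refine Finset.sup_le fun G hG => ?_
  simp only [mem_filter, mem_univ, true_and] at hG
  exact h G hG

/-- A graph without isolated vertices that is contained in the image of `G` under an embedding of
the vertices is contained in `G`. -/
theorem isContained_of_isContained_map {Y : Type*} {F : SimpleGraph Y} {G : SimpleGraph V}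
    (f : V ↪ W) (hF : ∀ y, ∃ z, F.Adj y z) (h : F.IsContained (G.map f)) : F.IsContained G := by
  obtain ⟨g⟩ := h
  have hmem : ∀ y, ∃ v, f v = g y := by
    intro y
    obtain ⟨z, hz⟩ := hF y
    have := g.toHom.map_rel hz
    obtain ⟨-, u, v, -, h1, -⟩ := this
    exact ⟨u, h1⟩
  choose k hk using hmem
  refine ⟨⟨⟨k, ?_⟩, ?_⟩⟩
  · intro y z hyz
    have := g.toHom.map_rel hyz
    rw [SimpleGraph.Copy.toHom_apply, SimpleGraph.Copy.toHom_apply, ← hk y, ← hk z,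
      SimpleGraph.map_adj_apply] at this
    exact this
  · intro y z hyz
    apply g.injective
    change k y = k z at hyz
    rw [SimpleGraph.Copy.toHom_apply, SimpleGraph.Copy.toHom_apply, ← hk y, ← hk z, hyz]

/-- Isolated vertices pad a smaller graph to n vertices. They cannot create a K_{s,t}, which has no
isolated vertex. -/
theorem copyCount_le_genEx [Fintype V] {G : SimpleGraph V} {a b s t n : ℕ} (ha : 1 ≤ a)
    (hb : 1 ≤ b) (hs : 1 ≤ s) (ht : 1 ≤ t) (hn : Fintype.card V ≤ n) (hG : (Kab s t).Free G) :
    G.copyCount (Kab a b) ≤ genEx n (Kab a b) (Kab s t) := by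
  obtain ⟨f⟩ : Nonempty (V ↪ Fin n) := by
    rw [Function.Embedding.nonempty_iff_card_le]; simpa using hn
  have hfree : (Kab s t).Free (G.map f) := by
    intro h
    refine hG (isContained_of_isContained_map f ?_ h)
    rintro (i | j)
    · exact ⟨.inr ⟨0, ht⟩, by simp⟩
    · exact ⟨.inl ⟨0, hs⟩, by simp⟩
  refine (copyCount_Kab_mono ha hb (card_bicliques_map_le
    (SimpleGraph.Embedding.map f G).toCopy a b)).trans ?_
  unfold genEx
  exact Finset.le_sup (f := fun G : SimpleGraph (Fin n) => G.copyCount (Kab a b))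
    (by simpa using hfree)

theorem degree_lt_of_free [Fintype V] {G : SimpleGraph V} {t : ℕ} (h : (Kab 1 t).Free G)
    (v : V) : #{x | G.Adj v x} < t := by
  by_contra hlt
  push Not at hlt
  obtain ⟨B, hB, hcard⟩ := exists_subset_card_eq hlt
  have : (({v}, B) : Finset V × Finset V) ∈ bicliques G univ 1 t := by
    rw [mem_bicliques]
    refine ⟨⟨⟨subset_univ _, by simp⟩, subset_univ _, hcard⟩, ?_⟩
    intro x hx y hy
    simp only [mem_singleton] at hx
    subst hx
    simpa using hB hy
  obtain ⟨f, -⟩ := exists_copy_of_mem_bicliques this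
  exact h ⟨f⟩

theorem free_of_common_lt [Fintype V] {G : SimpleGraph V} {s t : ℕ}
    (h : ∀ A : Finset V, #A = s → #{y | ∀ x ∈ A, G.Adj x y} < t) : (Kab s t).Free G := by
  rintro ⟨f⟩
  have := mem_bicliques.1 (copy_Kab_mem_bicliques f)
  refine absurd (h _ this.1.1.2) (not_lt.2 ?_)
  refine this.1.2.2.symm.le.trans (card_le_card fun y hy => ?_)
  simp only [mem_filter, mem_univ, true_and]
  exact fun x hx => this.2 x hx y hy

theorem free_of_degree_lt [Fintype V] {G : SimpleGraph V} {t : ℕ}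
    (h : ∀ v, #{x | G.Adj v x} < t) : (Kab 1 t).Free G := by
  refine free_of_common_lt fun A hA => ?_
  obtain ⟨v, rfl⟩ := card_eq_one.1 hA
  simpa using h v

end Bicliques

/-! ### Double counting under a degree bound; part (i). -/

section DegreeBound
open scoped Classical
open Finset

variable {V W : Type*}

/-- Each v is the first-side vertex of few pairs: B is a b-subset of N(v), and A \ {v} is an
(a-1)-subset of N(y) \ {v} for a fixed y ∈ B. -/
theorem mul_card_bicliques_le_of_degree_le [Fintype V] {G : SimpleGraph V} {D a b : ℕ}
    (hdeg : ∀ v, #{x | G.Adj v x} ≤ D) (hb : 1 ≤ b) :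
    a * #(bicliques G univ a b) ≤
      Fintype.card V * ((D - 1).choose (a - 1) * D.choose b) := by
  have hcount : a * #(bicliques G univ a b) =
      ∑ v : V, #{P ∈ bicliques G univ a b | v ∈ P.1} := by
    have h := sum_card_bipartiteAbove_eq_sum_card_bipartiteBelow
      (s := (univ : Finset V)) (t := bicliques G univ a b) (fun v P => v ∈ P.1)
    simp only [bipartiteAbove, bipartiteBelow] at h
    rw [h, sum_const_nat (m := a), mul_comm]
    intro P hP
    rw [← (mem_bicliques.1 hP).1.1.2]
    congr 1
    ext v
    simp
  rw [hcount, ← smul_eq_mul, ← card_univ]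
  refine sum_le_card_nsmul _ _ _ fun v _ => ?_
  have hmaps : ∀ P ∈ {P ∈ bicliques G univ a b | v ∈ P.1},
      P.2 ∈ powersetCard b {x | G.Adj v x} := by
    intro P hP
    rw [mem_filter, mem_bicliques] at hP
    rw [mem_powersetCard]
    exact ⟨fun y hy => by simpa using hP.1.2 v hP.2 y hy, hP.1.1.2.2⟩
  refine (card_le_mul_card_image_of_maps_to hmaps ((D - 1).choose (a - 1)) ?_).trans ?_
  · intro B hB
    rw [mem_powersetCard] at hB
    obtain ⟨y, hy⟩ : B.Nonempty := card_pos.1 (by omega)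
    have hyv : G.Adj v y := by simpa using hB.1 hy
    have hcard : #(({x | G.Adj y x} : Finset V).erase v) ≤ D - 1 := by
      rw [card_erase_of_mem (by simpa using hyv.symm)]
      exact Nat.sub_le_sub_right (hdeg y) 1
    refine le_trans ?_ (Nat.choose_le_choose (a - 1) hcard)
    rw [← card_powersetCard]
    refine card_le_card_of_injOn (fun P => P.1.erase v) ?_ ?_
    · intro P hP
      rw [mem_coe, mem_filter, mem_filter, mem_bicliques] at hP
      obtain ⟨⟨hP, hv⟩, rfl⟩ := hP
      rw [mem_coe, mem_powersetCard]
      refine ⟨erase_subset_erase _ fun x hx => ?_, ?_⟩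
      · simpa using (hP.2 x hx y hy).symm
      · rw [card_erase_of_mem hv, hP.1.1.2]
    · intro P hP Q hQ hPQ
      rw [mem_coe, mem_filter, mem_filter] at hP hQ
      refine Prod.ext ?_ (hP.2.trans hQ.2.symm)
      rw [← insert_erase hP.1.2, ← insert_erase hQ.1.2]
      exact congrArg _ hPQ
  · rw [card_powersetCard]
    exact Nat.mul_le_mul_left _ (Nat.choose_le_choose b (hdeg v))

theorem mul_choose_pred (D a : ℕ) (hD : 1 ≤ D) (ha : 1 ≤ a) :
    D * (D - 1).choose (a - 1) = a * D.choose a := by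
  obtain ⟨D, rfl⟩ := Nat.exists_eq_add_of_le' hD
  obtain ⟨a, rfl⟩ := Nat.exists_eq_add_of_le' ha
  simpa [mul_comm] using Nat.add_one_mul_choose_eq D a

/-- This form is symmetric in a and b and sharp: K_{D,D} has 2D vertices and 2 · C(D,a) · C(D,b)
ordered pairs when a, b ≥ 1. -/
theorem card_bicliques_mul_le [Fintype V] {G : SimpleGraph V} {D a b : ℕ}
    (hdeg : ∀ v, #{x | G.Adj v x} ≤ D) (hD : 1 ≤ D) (ha : 1 ≤ a) (hb : 1 ≤ b) :
    D * #(bicliques G univ a b) ≤ Fintype.card V * (D.choose a * D.choose b) := by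
  have h := Nat.mul_le_mul_left D (mul_card_bicliques_le_of_degree_le hdeg hb (a := a))
  refine Nat.le_of_mul_le_mul_left (c := a) ?_ ha
  calc a * (D * #(bicliques G univ a b)) = D * (a * #(bicliques G univ a b)) := by ring
    _ ≤ _ := h
    _ = Fintype.card V * ((D * (D - 1).choose (a - 1)) * D.choose b) := by ring
    _ = Fintype.card V * ((a * D.choose a) * D.choose b) := by rw [mul_choose_pred D a hD ha]
    _ = _ := by ring

/-- The two summands are the two ways of placing the first set. Only lower bounds are needed for the
extremal graphs, since their freeness bounds their copy counts by `genEx`. -/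
theorem le_card_bicliques_Kab {m n a b : ℕ} (ha : 1 ≤ a) :
    m.choose a * n.choose b + m.choose b * n.choose a ≤ #(bicliques (Kab m n) univ a b) := by
  have h1 : #((powersetCard a (univ : Finset (Fin m)) ×ˢ
      powersetCard b (univ : Finset (Fin n))).image
        fun P => ((P.1.map .inl, P.2.map .inr) :
          Finset (Fin m ⊕ Fin n) × Finset (Fin m ⊕ Fin n))) = m.choose a * n.choose b := by
    exact (card_image_of_injective _ ((Finset.map_injective _).prodMap
      (Finset.map_injective _))).trans (by simp)
  have h2 : #((powersetCard b (univ : Finset (Fin m)) ×ˢ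
      powersetCard a (univ : Finset (Fin n))).image
        fun P => ((P.2.map .inr, P.1.map .inl) :
          Finset (Fin m ⊕ Fin n) × Finset (Fin m ⊕ Fin n))) = m.choose b * n.choose a := by
    exact (card_image_of_injective _ (Prod.swap_injective.comp
      ((Finset.map_injective (.inl : Fin m ↪ Fin m ⊕ Fin n)).prodMap
        (Finset.map_injective (.inr : Fin n ↪ Fin m ⊕ Fin n))))).trans (by simp)
  rw [← h1, ← h2, ← card_union_of_disjoint]
  · refine card_le_card fun P hP => ?_
    rw [mem_union, mem_image, mem_image] at hP
    rcases hP with ⟨Q, hQ, rfl⟩ | ⟨Q, hQ, rfl⟩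
    · rw [mem_product, mem_powersetCard, mem_powersetCard] at hQ
      refine mem_bicliques.2 ⟨⟨⟨subset_univ _, ?_⟩, subset_univ _, ?_⟩, ?_⟩
      · simpa using hQ.1.2
      · simpa using hQ.2.2
      · simp only [Finset.mem_map]
        rintro _ ⟨x, -, rfl⟩ _ ⟨y, -, rfl⟩
        simp
    · rw [mem_product, mem_powersetCard, mem_powersetCard] at hQ
      refine mem_bicliques.2 ⟨⟨⟨subset_univ _, ?_⟩, subset_univ _, ?_⟩, ?_⟩
      · simpa using hQ.2.2
      · simpa using hQ.1.2
      · simp only [Finset.mem_map]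
        rintro _ ⟨x, -, rfl⟩ _ ⟨y, -, rfl⟩
        simp
  · rw [Finset.disjoint_left]
    intro P hP hP'
    rw [mem_image] at hP hP'
    obtain ⟨Q, hQ, rfl⟩ := hP
    obtain ⟨R, -, hR⟩ := hP'
    rw [mem_product, mem_powersetCard, mem_powersetCard] at hQ
    obtain ⟨x, hx⟩ : Q.1.Nonempty := card_pos.1 (by omega)
    have hx' : (Sum.inl x : Fin m ⊕ Fin n) ∈ Q.1.map .inl := mem_map_of_mem _ hx
    have h := congrArg Prod.fst hR
    dsimp only at h
    rw [← h] at hx'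
    simp at hx'

theorem card_bicliques_add_le_sum [Fintype V] [Fintype W] (G : SimpleGraph V)
    (H : SimpleGraph W) {a b : ℕ} (ha : 1 ≤ a) :
    #(bicliques G univ a b) + #(bicliques H univ a b) ≤ #(bicliques (G.sum H) univ a b) := by
  have h1 : #((bicliques G univ a b).image fun P =>
      ((P.1.map .inl, P.2.map .inl) : Finset (V ⊕ W) × Finset (V ⊕ W))) =
      #(bicliques G univ a b) :=
    card_image_of_injective _ ((Finset.map_injective (.inl : V ↪ V ⊕ W)).prodMap
      (Finset.map_injective (.inl : V ↪ V ⊕ W)))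
  have h2 : #((bicliques H univ a b).image fun P =>
      ((P.1.map .inr, P.2.map .inr) : Finset (V ⊕ W) × Finset (V ⊕ W))) =
      #(bicliques H univ a b) :=
    card_image_of_injective _ ((Finset.map_injective (.inr : W ↪ V ⊕ W)).prodMap
      (Finset.map_injective (.inr : W ↪ V ⊕ W)))
  rw [← h1, ← h2, ← card_union_of_disjoint]
  · refine card_le_card fun P hP => ?_
    rw [mem_union, mem_image, mem_image] at hP
    rcases hP with ⟨Q, hQ, rfl⟩ | ⟨Q, hQ, rfl⟩
    · exact map_mem_bicliques (SimpleGraph.Embedding.sumInl (G := G) (H := H)).toCopy hQ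
    · exact map_mem_bicliques (SimpleGraph.Embedding.sumInr (G := G) (H := H)).toCopy hQ
  · rw [Finset.disjoint_left]
    intro P hP hP'
    rw [mem_image] at hP hP'
    obtain ⟨Q, hQ, rfl⟩ := hP
    obtain ⟨R, -, hR⟩ := hP'
    rw [mem_bicliques] at hQ
    obtain ⟨x, hx⟩ : Q.1.Nonempty := card_pos.1 (by omega)
    have hx' : (Sum.inl x : V ⊕ W) ∈ Q.1.map .inl := mem_map_of_mem _ hx
    have h := congrArg Prod.fst hR
    dsimp only at h
    rw [← h] at hx'
    simp at hx'

/-- The inclusion of one of the disjoint copies. -/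
def disjointCopiesCopy {k : ℕ} (G : SimpleGraph V) (i : Fin k) :
    SimpleGraph.Copy G (disjointCopies k G) where
  toHom := ⟨fun v => (i, v), fun h => ⟨rfl, h⟩⟩
  injective' _ _ h := (Prod.ext_iff.1 h).2

theorem mul_card_bicliques_le_disjointCopies [Fintype V] (G : SimpleGraph V) (k : ℕ) {a b : ℕ}
    (ha : 1 ≤ a) :
    k * #(bicliques G univ a b) ≤ #(bicliques (disjointCopies k G) univ a b) := by
  have h : #((univ : Finset (Fin k)) ×ˢ bicliques G univ a b) = k * #(bicliques G univ a b) := by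
    simp
  rw [← h]
  refine card_le_card_of_injOn (fun p => (p.2.1.map (disjointCopiesCopy G p.1).toEmbedding,
    p.2.2.map (disjointCopiesCopy G p.1).toEmbedding)) ?_ ?_
  · rintro ⟨i, P⟩ hP
    rw [mem_coe, mem_product] at hP
    exact map_mem_bicliques (disjointCopiesCopy G i) hP.2
  · rintro ⟨i, P⟩ hP ⟨j, Q⟩ hQ hPQ
    rw [mem_coe, mem_product] at hP
    obtain ⟨x, hx⟩ : P.1.Nonempty := by
      refine card_pos.1 ?_
      have := (mem_bicliques.1 hP.2).1.1.2
      exact ha.trans this.ge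
    have hx' : (i, x) ∈ P.1.map (disjointCopiesCopy G i).toEmbedding := mem_map_of_mem _ hx
    have h1 := congrArg Prod.fst hPQ
    have h2 := congrArg Prod.snd hPQ
    dsimp only at h1 h2
    rw [h1] at hx'
    obtain ⟨y, -, hy⟩ := Finset.mem_map.1 hx'
    obtain rfl : j = i := congrArg Prod.fst hy
    exact Prod.ext rfl (Prod.ext (Finset.map_injective _ h1) (Finset.map_injective _ h2))

theorem degree_Kab_le {m n D : ℕ} (hm : m ≤ D) (hn : n ≤ D) (v : Fin m ⊕ Fin n) :
    #{x | (Kab m n).Adj v x} ≤ D := by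
  rcases v with i | j
  · refine le_trans (b := #((univ : Finset (Fin n)).map .inr))
      (card_le_card fun x hx => ?_) (by simpa)
    rcases x with x | x <;> simp at hx ⊢
  · refine le_trans (b := #((univ : Finset (Fin m)).map .inl))
      (card_le_card fun x hx => ?_) (by simpa)
    rcases x with x | x <;> simp at hx ⊢

theorem degree_disjointCopies_le [Fintype V] {G : SimpleGraph V} {D k : ℕ}
    (h : ∀ v, #{x | G.Adj v x} ≤ D) (v : Fin k × V) :
    #{x | (disjointCopies k G).Adj v x} ≤ D := by
  refine le_trans ?_ (h v.2)
  refine card_le_card_of_injOn Prod.snd (fun x hx => ?_) fun x hx y hy hxy => ?_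
  · simp only [coe_filter, mem_univ, true_and, Set.mem_ofPred_eq] at hx ⊢
    exact hx.2
  · simp only [coe_filter, mem_univ, true_and, Set.mem_ofPred_eq] at hx hy
    exact Prod.ext (hx.1.symm.trans hy.1) hxy

theorem degree_sum_le [Fintype V] [Fintype W] {G : SimpleGraph V} {H : SimpleGraph W} {D : ℕ}
    (hG : ∀ v, #{x | G.Adj v x} ≤ D) (hH : ∀ v, #{x | H.Adj v x} ≤ D) (v : V ⊕ W) :
    #{x | (G.sum H).Adj v x} ≤ D := by
  rcases v with v | v
  · refine le_trans (le_trans (card_le_card (t := Finset.map .inl {x | G.Adj v x})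
      fun x hx => ?_) (card_map _).le) (hG v)
    rcases x with x | x <;> simp at hx ⊢
    exact hx
  · refine le_trans (le_trans (card_le_card (t := Finset.map .inr {x | H.Adj v x})
      fun x hx => ?_) (card_map _).le) (hH v)
    rcases x with x | x <;> simp at hx ⊢
    exact hx

/-- The loss against the sharp bound comes from replacing C(D-1,c-1) by C(D,c-1) in D · C(D-1,c-1) =
c · C(D,c), for c = a and c = b. -/
theorem real_le_of_mul_le {D N n a b : ℕ} (hD : 1 ≤ D) (ha : 1 ≤ a) (hb : 1 ≤ b)
    (h : D * N ≤ n * (D.choose a * D.choose b)) :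
    (N : ℝ) ≤ (n : ℝ) / ((a : ℝ) + (b : ℝ)) *
      ((D.choose a : ℝ) * (D.choose (b - 1) : ℝ) + (D.choose b : ℝ) * (D.choose (a - 1) : ℝ)) := by
  have key : ∀ c, 1 ≤ c → c * D.choose c ≤ D * D.choose (c - 1) := fun c hc => by
    rw [← mul_choose_pred D c hD hc]
    exact Nat.mul_le_mul_left _ (Nat.choose_le_choose _ (Nat.sub_le _ _))
  have hmain : (a + b) * N ≤
      n * (D.choose a * D.choose (b - 1) + D.choose b * D.choose (a - 1)) := by
    refine Nat.le_of_mul_le_mul_left (c := D) ?_ hD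
    calc D * ((a + b) * N) = (a + b) * (D * N) := by ring
      _ ≤ (a + b) * (n * (D.choose a * D.choose b)) := Nat.mul_le_mul_left _ h
      _ = n * (D.choose b * (a * D.choose a) + D.choose a * (b * D.choose b)) := by ring
      _ ≤ n * (D.choose b * (D * D.choose (a - 1)) + D.choose a * (D * D.choose (b - 1))) := by
        exact Nat.mul_le_mul_left _ (Nat.add_le_add (Nat.mul_le_mul_left _ (key a ha))
          (Nat.mul_le_mul_left _ (key b hb)))
      _ = _ := by ring
  have hpos : (0 : ℝ) < (a : ℝ) + b := by positivity
  rw [div_mul_eq_mul_div, le_div_iff₀ hpos, mul_comm]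
  exact_mod_cast hmain

theorem degree_le_pred_of_free [Fintype V] {G : SimpleGraph V} {t : ℕ} (h : (Kab 1 t).Free G)
    (v : V) : #{x | G.Adj v x} ≤ t - 1 :=
  Nat.le_sub_one_of_lt (degree_lt_of_free h v)

theorem genEx_Kab_star_le {a b t : ℕ} (n : ℕ) (ha : 1 ≤ a) (hab : a < b) (hbt : b < t) :
    (genEx n (Kab a b) (Kab 1 t) : ℝ) ≤ (n : ℝ) / ((a : ℝ) + (b : ℝ)) *
      (((t - 1).choose a : ℝ) * ((t - 1).choose (b - 1) : ℝ) +
        ((t - 1).choose b : ℝ) * ((t - 1).choose (a - 1) : ℝ)) := by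
  refine real_le_of_mul_le (by omega) ha (by omega) ?_
  have hD : 0 < t - 1 := by omega
  -- A supremum is bounded termwise only in the form `copyCount ≤ c`, so the factor D is moved into
  -- a floor division and back.
  rw [mul_comm, ← Nat.le_div_iff_mul_le hD]
  refine genEx_le fun G hG => ?_
  rw [Nat.le_div_iff_mul_le hD, mul_comm]
  have h := card_bicliques_mul_le (degree_le_pred_of_free hG) (by omega) ha (b := b) (by omega)
  rwa [← copyCount_Kab G ha (by omega), if_neg hab.ne, mul_one, Fintype.card_fin] at h

theorem genEx_Kab_self_star_le {a t : ℕ} (n : ℕ) (ha : 1 ≤ a) (hat : a < t) :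
    (genEx n (Kab a a) (Kab 1 t) : ℝ) ≤ (n : ℝ) / (2 * (a : ℝ)) *
      (((t - 1).choose a : ℝ) * ((t - 1).choose (a - 1) : ℝ)) := by
  have hD : 0 < t - 1 := by omega
  have key : (t - 1) * (genEx n (Kab a a) (Kab 1 t) * 2) ≤
      n * ((t - 1).choose a * (t - 1).choose a) := by
    rw [mul_comm, ← Nat.le_div_iff_mul_le hD, ← Nat.le_div_iff_mul_le two_pos]
    refine genEx_le fun G hG => ?_
    rw [Nat.le_div_iff_mul_le two_pos, Nat.le_div_iff_mul_le hD, mul_comm]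
    have h := card_bicliques_mul_le (degree_le_pred_of_free hG) (by omega) ha ha
    rwa [← copyCount_Kab G ha ha, if_pos rfl, Fintype.card_fin] at h
  have h := real_le_of_mul_le hD ha ha key
  push_cast at h
  have ha' : (0 : ℝ) < a := by exact_mod_cast ha
  have e : (n : ℝ) / (2 * (a : ℝ)) *
      (((t - 1).choose a : ℝ) * ((t - 1).choose (a - 1) : ℝ)) = (n : ℝ) / ((a : ℝ) + a) *
      (((t - 1).choose a : ℝ) * ((t - 1).choose (a - 1) : ℝ) +
        ((t - 1).choose a : ℝ) * ((t - 1).choose (a - 1) : ℝ)) / 2 := by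
    ring
  rw [e]
  linarith

theorem genEx_Kab_star_eq_of_dvd {a b t n : ℕ} (ha : 1 ≤ a) (hab : a ≤ b) (hbt : b < t)
    (hn : 2 * t - 2 ∣ n) : genEx n (Kab a b) (Kab 1 t) =
      (disjointCopies (n / (2 * t - 2)) (Kab (t - 1) (t - 1))).copyCount (Kab a b) := by
  obtain ⟨k, rfl⟩ := hn
  rw [Nat.mul_div_cancel_left _ (by omega)]
  obtain ⟨D, rfl⟩ : ∃ D, t = D + 1 := ⟨t - 1, by omega⟩
  rw [Nat.add_sub_cancel, show 2 * (D + 1) - 2 = 2 * D by omega]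
  have hb : 1 ≤ b := ha.trans hab
  apply le_antisymm
  · refine genEx_le fun G hG => copyCount_Kab_mono ha hb ?_
    have h := card_bicliques_mul_le (degree_le_pred_of_free hG) (by omega) ha hb
    rw [Nat.add_sub_cancel, Fintype.card_fin] at h
    refine le_trans ?_ (mul_card_bicliques_le_disjointCopies _ k ha)
    refine le_trans ?_ (Nat.mul_le_mul_left k (le_card_bicliques_Kab ha))
    refine Nat.le_of_mul_le_mul_left (c := D) (h.trans (le_of_eq ?_)) (by omega)
    ring
  · refine copyCount_le_genEx ha hb le_rfl (by omega) ?_ (free_of_degree_lt fun v =>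
      Nat.lt_succ_of_le (degree_disjointCopies_le (degree_Kab_le le_rfl le_rfl) v))
    simp only [Fintype.card_prod, Fintype.card_fin, Fintype.card_sum]
    exact le_of_eq (by ring)

end DegreeBound

/-! ### Convexity of the balanced count and superadditivity of the packed count. -/

section BalancedCount

/-- The number of copies of `K_{a,a}` in the balanced complete bipartite graph on `m` vertices. -/
def balancedCount (a m : ℕ) : ℕ := (m / 2).choose a * ((m + 1) / 2).choose a

theorem balancedCount_zero {a : ℕ} (ha : 1 ≤ a) : balancedCount a 0 = 0 := by
  simp [balancedCount, Nat.choose_eq_zero_of_lt (show 0 < a from ha)]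

theorem balancedCount_two_mul (a D : ℕ) : balancedCount a (2 * D) = D.choose a * D.choose a := by
  unfold balancedCount
  rw [show 2 * D / 2 = D by omega, show (2 * D + 1) / 2 = D by omega]

theorem balancedCount_succ {a : ℕ} (ha : 1 ≤ a) (m : ℕ) : balancedCount a (m + 1) =
    balancedCount a m + ((m + 1) / 2).choose a * (m / 2).choose (a - 1) := by
  obtain ⟨c, rfl⟩ := Nat.exists_eq_add_of_le' ha
  unfold balancedCount
  rw [Nat.add_sub_cancel]
  obtain ⟨k, rfl | rfl⟩ : ∃ k, m = 2 * k ∨ m = 2 * k + 1 := ⟨m / 2, by omega⟩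
  · rw [show (2 * k + 1) / 2 = k by omega, show 2 * k / 2 = k by omega,
      show (2 * k + 1 + 1) / 2 = k + 1 by omega, Nat.choose_succ_succ]
    ring
  · rw [show (2 * k + 1) / 2 = k by omega, show (2 * k + 1 + 1) / 2 = k + 1 by omega,
      show (2 * k + 1 + 1 + 1) / 2 = k + 1 by omega, Nat.choose_succ_succ]
    ring

/-- The increments given by `balancedCount_succ` are nondecreasing in m, so k steps from y gain at
least as much as k steps from z. -/
theorem balancedCount_shift {a z y : ℕ} (ha : 1 ≤ a) (hzy : z ≤ y) (k : ℕ) :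
    balancedCount a (z + k) + balancedCount a y ≤ balancedCount a z + balancedCount a (y + k) := by
  induction k with
  | zero => exact le_of_eq rfl
  | succ k ih =>
    rw [← add_assoc, ← add_assoc, balancedCount_succ ha, balancedCount_succ ha]
    have : ((z + k + 1) / 2).choose a * ((z + k) / 2).choose (a - 1) ≤
        ((y + k + 1) / 2).choose a * ((y + k) / 2).choose (a - 1) :=
      Nat.mul_le_mul (Nat.choose_le_choose _ (Nat.div_le_div_right (by omega)))
        (Nat.choose_le_choose _ (Nat.div_le_div_right (by omega)))
    omega

/-- Moving one vertex from the larger side to the smaller does not lose copies. After Pascal's rule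
it remains to compare x - c with y - c. -/
theorem choose_mul_choose_succ_le {x y : ℕ} (a : ℕ) (hxy : x ≤ y) :
    x.choose a * (y + 1).choose a ≤ (x + 1).choose a * y.choose a := by
  rcases a with _ | c
  · simp
  have key : x.choose (c + 1) * y.choose c ≤ x.choose c * y.choose (c + 1) := by
    refine Nat.le_of_mul_le_mul_right (c := c + 1) ?_ (Nat.succ_pos c)
    calc x.choose (c + 1) * y.choose c * (c + 1)
        = y.choose c * (x.choose (c + 1) * (c + 1)) := by ring
      _ = y.choose c * x.choose c * (x - c) := by rw [Nat.choose_succ_right_eq]; ring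
      _ ≤ y.choose c * x.choose c * (y - c) :=
          Nat.mul_le_mul_left _ (Nat.sub_le_sub_right hxy c)
      _ = x.choose c * (y.choose (c + 1) * (c + 1)) := by rw [Nat.choose_succ_right_eq]; ring
      _ = _ := by ring
  rw [Nat.choose_succ_succ, Nat.choose_succ_succ]
  linarith

theorem choose_mul_choose_le_balancedCount (a : ℕ) : ∀ d x y : ℕ, x ≤ y → y - x ≤ d →
    x.choose a * y.choose a ≤ balancedCount a (x + y) := by
  intro d
  induction d with
  | zero =>
    intro x y hxy hd
    obtain rfl : x = y := by omega
    rw [← two_mul, balancedCount_two_mul]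
  | succ d ih =>
    intro x y hxy hd
    rcases lt_or_ge y (x + 2) with h | h
    · unfold balancedCount
      rw [show (x + y) / 2 = x by omega, show (x + y + 1) / 2 = y by omega]
    · obtain ⟨z, rfl⟩ : ∃ z, y = z + 1 := ⟨y - 1, by omega⟩
      refine (choose_mul_choose_succ_le a (by omega)).trans ?_
      rw [show x + (z + 1) = (x + 1) + z by ring]
      exact ih _ _ (by omega) (by omega)

theorem choose_mul_choose_le (a x y : ℕ) :
    x.choose a * y.choose a ≤ balancedCount a (x + y) := by
  rcases le_total x y with h | h
  · exact choose_mul_choose_le_balancedCount a _ x y h le_rfl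
  · rw [mul_comm, add_comm]
    exact choose_mul_choose_le_balancedCount a _ y x h le_rfl

/-- The number of copies of `K_{a,a}` in the disjoint union of as many copies of `K_{D,D}` as fit
into `n` vertices and a balanced complete bipartite graph on the remaining vertices. -/
def packedCount (D a n : ℕ) : ℕ :=
  n / (2 * D) * balancedCount a (2 * D) + balancedCount a (n % (2 * D))

theorem packedCount_add_le {D a : ℕ} (hD : 1 ≤ D) (ha : 1 ≤ a) (m n : ℕ) :
    packedCount D a m + packedCount D a n ≤ packedCount D a (m + n) := by
  have hN : 0 < 2 * D := by omega
  have hm := Nat.mod_lt m hN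
  have hn := Nat.mod_lt n hN
  unfold packedCount
  rw [Nat.add_div hN, Nat.add_mod]
  generalize m % (2 * D) = r at *
  generalize n % (2 * D) = s at *
  split_ifs with h
  · rw [Nat.mod_eq_sub_mod h, Nat.mod_eq_of_lt (show r + s - 2 * D < 2 * D by omega)]
    -- With overflow, r and s are pushed apart with fixed sum until one of them is the full block 2D
    -- and the other is r + s - 2D.
    have := balancedCount_shift ha (show r + s - 2 * D ≤ s by omega) (2 * D - s)
    rw [show r + s - 2 * D + (2 * D - s) = r by omega, show s + (2 * D - s) = 2 * D by omega]
      at this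
    linarith
  · rw [Nat.mod_eq_of_lt (show r + s < 2 * D by omega)]
    have := balancedCount_shift ha (Nat.zero_le s) r
    rw [zero_add, balancedCount_zero ha, add_comm s r] at this
    linarith

theorem packedCount_mono {D a : ℕ} (hD : 1 ≤ D) (ha : 1 ≤ a) {m n : ℕ} (h : m ≤ n) :
    packedCount D a m ≤ packedCount D a n := by
  obtain ⟨k, rfl⟩ := Nat.exists_eq_add_of_le h
  exact (Nat.le_add_right _ _).trans (packedCount_add_le hD ha m k)

theorem balancedCount_le_packedCount {D a m : ℕ} (hD : 1 ≤ D) (hm : m ≤ 2 * D) :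
    balancedCount a m ≤ packedCount D a m := by
  unfold packedCount
  rcases hm.eq_or_lt with rfl | h
  · rw [Nat.div_self (by omega), one_mul]
    exact Nat.le_add_right _ _
  · rw [Nat.mod_eq_of_lt h]
    exact Nat.le_add_left _ _

end BalancedCount

/-! ### Classes of intersecting pairs when 7D ≤ 8a; part (ii). -/

section Clusters
open scoped Classical
open Finset

variable {V : Type*} [Fintype V] {G : SimpleGraph V} {D a : ℕ} {S X Y : Finset V}

theorem card_union_le_of_inter_nonempty (hdeg : ∀ v, #{x | G.Adj v x} ≤ D)
    {P Q : Finset V × Finset V} (hP : P ∈ bicliques G S a a) (hQ : Q ∈ bicliques G S a a)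
    (h : (P.1 ∩ Q.1).Nonempty) : #(P.2 ∪ Q.2) ≤ D := by
  obtain ⟨x, hx⟩ := h
  rw [mem_inter] at hx
  refine (card_le_card fun y hy => ?_).trans (hdeg x)
  rw [mem_filter]
  refine ⟨mem_univ _, ?_⟩
  rcases mem_union.1 hy with hy | hy
  · exact (mem_bicliques.1 hP).2 x hx.1 y hy
  · exact (mem_bicliques.1 hQ).2 x hx.2 y hy

theorem le_card_inter_snd (hdeg : ∀ v, #{x | G.Adj v x} ≤ D) (hDa : 7 * D ≤ 8 * a)
    {P Q : Finset V × Finset V} (hP : P ∈ bicliques G S a a) (hQ : Q ∈ bicliques G S a a)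
    (h : (P.1 ∩ Q.1).Nonempty) : 6 * a ≤ 7 * #(P.2 ∩ Q.2) := by
  have h1 := card_union_le_of_inter_nonempty hdeg hP hQ h
  have h2 := card_union_add_card_inter P.2 Q.2
  have h3 := (mem_bicliques.1 hP).1.2.2
  have h4 := (mem_bicliques.1 hQ).1.2.2
  omega

theorem inter_snd_nonempty (hdeg : ∀ v, #{x | G.Adj v x} ≤ D) (hDa : 7 * D ≤ 8 * a)
    (ha : 1 ≤ a) {P Q : Finset V × Finset V} (hP : P ∈ bicliques G S a a)
    (hQ : Q ∈ bicliques G S a a) (h : (P.1 ∩ Q.1).Nonempty) : (P.2 ∩ Q.2).Nonempty := by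
  have := le_card_inter_snd hdeg hDa hP hQ h
  exact card_pos.1 (by omega)

/-- Meeting first sets force meeting second sets; swapping the roles then turns mere intersection
into a 6/7 overlap. -/
theorem le_card_inter_fst (hdeg : ∀ v, #{x | G.Adj v x} ≤ D) (hDa : 7 * D ≤ 8 * a)
    (ha : 1 ≤ a) {P Q : Finset V × Finset V} (hP : P ∈ bicliques G S a a)
    (hQ : Q ∈ bicliques G S a a) (h : (P.1 ∩ Q.1).Nonempty) : 6 * a ≤ 7 * #(P.1 ∩ Q.1) :=
  le_card_inter_snd hdeg hDa (swap_mem_bicliques hP) (swap_mem_bicliques hQ)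
    (inter_snd_nonempty hdeg hDa ha hP hQ h)

/-- Two subsets of Q.1 that each contain 6/7 of it must meet. -/
theorem inter_fst_nonempty_trans (hdeg : ∀ v, #{x | G.Adj v x} ≤ D) (hDa : 7 * D ≤ 8 * a)
    (ha : 1 ≤ a) {P Q R : Finset V × Finset V} (hP : P ∈ bicliques G S a a)
    (hQ : Q ∈ bicliques G S a a) (hR : R ∈ bicliques G S a a) (h : (P.1 ∩ Q.1).Nonempty)
    (h' : (Q.1 ∩ R.1).Nonempty) : (P.1 ∩ R.1).Nonempty := by
  have h1 := le_card_inter_fst hdeg hDa ha hP hQ h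
  have h2 := le_card_inter_fst hdeg hDa ha hQ hR h'
  have h3 := (mem_bicliques.1 hQ).1.1.2
  refine (inter_nonempty_of_card_lt_card_add_card (inter_subset_right (s₁ := P.1) (s₂ := Q.1))
    (inter_subset_left (s₁ := Q.1) (s₂ := R.1)) (by omega)).mono ?_
  intro x hx
  simp only [mem_inter] at hx ⊢
  exact ⟨hx.1.1, hx.2.2⟩

/-- Given B, the first set lies in X ∩ N(y) with y ∈ B, of size at most min(D, |X|). The minimum
keeps both sides at most D, so that the balanced graph fits into one block of 2D vertices. -/
theorem card_family_le_packedCount (hdeg : ∀ v, #{x | G.Adj v x} ≤ D) (hD : 1 ≤ D) (ha : 1 ≤ a)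
    {C : Finset (Finset V × Finset V)} (hC : C ⊆ bicliques G S a a) (hX : ∀ P ∈ C, P.1 ⊆ X)
    (hY : ∀ P ∈ C, P.2 ⊆ Y) (hYD : #Y ≤ D) : #C ≤ packedCount D a (#X + #Y) := by
  have hmaps : ∀ P ∈ C, P.2 ∈ powersetCard a Y := fun P hP =>
    mem_powersetCard.2 ⟨hY P hP, (mem_bicliques.1 (hC hP)).1.2.2⟩
  have hle : #C ≤ (min D #X).choose a * (#Y).choose a := by
    rw [← card_powersetCard a Y]
    refine card_le_mul_card_image_of_maps_to hmaps _ fun B hB => ?_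
    rw [mem_powersetCard] at hB
    obtain ⟨y, hy⟩ : B.Nonempty := card_pos.1 (by omega)
    have hcard : #(X ∩ ({x | G.Adj y x} : Finset V)) ≤ min D #X :=
      le_min ((card_le_card inter_subset_right).trans (hdeg y)) (card_le_card inter_subset_left)
    refine le_trans ?_ (Nat.choose_le_choose a hcard)
    rw [← card_powersetCard]
    refine card_le_card_of_injOn Prod.fst ?_ ?_
    · intro P hP
      rw [mem_coe, mem_filter] at hP
      obtain ⟨hP, rfl⟩ := hP
      have hP' := mem_bicliques.1 (hC hP)
      rw [mem_coe, mem_powersetCard]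
      refine ⟨fun x hx => mem_inter.2 ⟨hX P hP hx, ?_⟩, hP'.1.1.2⟩
      simpa using (hP'.2 x hx y hy).symm
    · intro P hP Q hQ hPQ
      rw [mem_coe, mem_filter] at hP hQ
      exact Prod.ext hPQ (hP.2.trans hQ.2.symm)
  refine hle.trans ((choose_mul_choose_le a _ _).trans
    ((balancedCount_le_packedCount hD ?_).trans (packedCount_mono hD ha ?_)))
  · have := min_le_left D #X
    omega
  · exact Nat.add_le_add_right (min_le_right _ _) _

/-- Count edges between a fixed first set A and Y: each y ∈ Y has at least 6a/7 neighbours in A,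
while A sends out at most aD edges. -/
theorem card_snd_union_le (hdeg : ∀ v, #{x | G.Adj v x} ≤ D) (hDa : 7 * D ≤ 8 * a)
    (ha : 1 ≤ a) {C : Finset (Finset V × Finset V)} (hC : C ⊆ bicliques G S a a)
    (hinter : ∀ P ∈ C, ∀ Q ∈ C, (P.1 ∩ Q.1).Nonempty) (hne : C.Nonempty) :
    6 * #(C.biUnion Prod.snd) ≤ 7 * D := by
  obtain ⟨P, hP⟩ := hne
  have hP' := mem_bicliques.1 (hC hP)
  have h := sum_card_bipartiteAbove_eq_sum_card_bipartiteBelow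
    (s := P.1) (t := C.biUnion Prod.snd) (fun x y => G.Adj x y)
  have h1 : ∑ x ∈ P.1, #(bipartiteAbove (fun x y => G.Adj x y) (C.biUnion Prod.snd) x)
      ≤ a * D := by
    rw [← hP'.1.1.2, ← smul_eq_mul]
    refine sum_le_card_nsmul _ _ _ fun x _ => ?_
    exact (card_le_card (filter_subset_filter _ (subset_univ _))).trans (hdeg x)
  have h2 : 6 * a * #(C.biUnion Prod.snd) ≤
      7 * ∑ y ∈ C.biUnion Prod.snd, #(bipartiteBelow (fun x y => G.Adj x y) P.1 y) := by
    rw [mul_sum, mul_comm, ← smul_eq_mul]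
    refine card_nsmul_le_sum _ _ _ fun y hy => ?_
    obtain ⟨Q, hQ, hyQ⟩ := mem_biUnion.1 hy
    refine (le_card_inter_fst hdeg hDa ha (hC hP) (hC hQ) (hinter P hP Q hQ)).trans
      (Nat.mul_le_mul_left _ (card_le_card fun x hx => ?_))
    rw [mem_inter] at hx
    exact mem_filter.2 ⟨hx.1, (mem_bicliques.1 (hC hQ)).2 x hx.2 y hyQ⟩
  rw [← h] at h2
  refine Nat.le_of_mul_le_mul_left (c := a) ?_ ha
  calc a * (6 * #(C.biUnion Prod.snd)) = 6 * a * #(C.biUnion Prod.snd) := by ring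
    _ ≤ 7 * (a * D) := h2.trans (Nat.mul_le_mul_left _ h1)
    _ = _ := by ring

/-- If A had D common neighbours in Y, they would be the whole neighbourhood of each vertex of A.
Every first set in the family meets A, so all of Y would lie there, contradicting |Y| > D. -/
theorem card_common_lt (hdeg : ∀ v, #{x | G.Adj v x} ≤ D)
    {C : Finset (Finset V × Finset V)} (hC : C ⊆ bicliques G S a a)
    (hinter : ∀ P ∈ C, ∀ Q ∈ C, (P.1 ∩ Q.1).Nonempty) (hY : D < #(C.biUnion Prod.snd))
    {P : Finset V × Finset V} (hP : P ∈ C) :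
    #{y ∈ C.biUnion Prod.snd | ∀ x ∈ P.1, G.Adj x y} < D := by
  by_contra hcon
  push Not at hcon
  have hN : ∀ x ∈ P.1, ({y ∈ C.biUnion Prod.snd | ∀ x ∈ P.1, G.Adj x y} : Finset V) =
      ({y | G.Adj x y} : Finset V) := by
    intro x hx
    refine eq_of_subset_of_card_le (fun y hy => ?_) ((hdeg x).trans hcon)
    rw [mem_filter] at hy ⊢
    exact ⟨mem_univ _, hy.2 x hx⟩
  have hsub : C.biUnion Prod.snd ⊆
      ({y ∈ C.biUnion Prod.snd | ∀ x ∈ P.1, G.Adj x y} : Finset V) := by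
    intro y hy
    obtain ⟨Q, hQ, hyQ⟩ := mem_biUnion.1 hy
    obtain ⟨x, hx⟩ := hinter P hP Q hQ
    rw [mem_inter] at hx
    rw [hN x hx.1, mem_filter]
    exact ⟨mem_univ _, (mem_bicliques.1 (hC hQ)).2 x hx.2 y hyQ⟩
  obtain ⟨x, hx⟩ := hinter P hP P hP
  have h := card_le_card hsub
  rw [hN x (mem_inter.1 hx).1] at h
  exact absurd (hY.trans_le h) (not_lt.2 (hdeg x))

/-- A first set with d ≤ D - 1 common neighbours in Y lies in at most C(d,a) pairs, and a · C(d,a) =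
d · C(d-1,a-1) ≤ d · C(D-2,a-1). The sum of the d is at most |Y| · C(D,a), since each y sees at most
C(D,a) first sets. -/
theorem mul_card_family_le (hdeg : ∀ v, #{x | G.Adj v x} ≤ D) (ha : 1 ≤ a)
    {C : Finset (Finset V × Finset V)} (hC : C ⊆ bicliques G S a a)
    (hinter : ∀ P ∈ C, ∀ Q ∈ C, (P.1 ∩ Q.1).Nonempty) (hY : D < #(C.biUnion Prod.snd)) :
    a * #C ≤ #(C.biUnion Prod.snd) * D.choose a * (D - 2).choose (a - 1) := by
  set Y := C.biUnion Prod.snd with hYdef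
  have hmaps : Set.MapsTo Prod.fst (C : Set (Finset V × Finset V)) (C.image Prod.fst : Finset _) :=
    fun P hP => mem_coe.2 (mem_image_of_mem _ (mem_coe.1 hP))
  have hfiber : ∀ A ∈ C.image Prod.fst, a * #{P ∈ C | P.1 = A} ≤
      #(bipartiteAbove (fun A y => ∀ x ∈ A, G.Adj x y) Y A) * (D - 2).choose (a - 1) := by
    intro A hA
    obtain ⟨P, hP, rfl⟩ := mem_image.1 hA
    have hlt := card_common_lt hdeg hC hinter hY hP
    change #(bipartiteAbove (fun A y => ∀ x ∈ A, G.Adj x y) Y P.1) < D at hlt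
    set d := #(bipartiteAbove (fun A y => ∀ x ∈ A, G.Adj x y) Y P.1) with hd
    have hle : #{Q ∈ C | Q.1 = P.1} ≤ d.choose a := by
      rw [hd, ← card_powersetCard]
      refine card_le_card_of_injOn Prod.snd ?_ ?_
      · intro Q hQ
        rw [mem_coe, mem_filter] at hQ
        have hQ' := mem_bicliques.1 (hC hQ.1)
        rw [mem_coe, mem_powersetCard]
        refine ⟨fun y hy => mem_filter.2 ⟨mem_biUnion.2 ⟨Q, hQ.1, hy⟩, fun x hx => ?_⟩, hQ'.1.2.2⟩
        exact hQ'.2 x (hQ.2 ▸ hx) y hy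
      · intro Q hQ R hR hQR
        rw [mem_coe, mem_filter] at hQ hR
        exact Prod.ext (hQ.2.trans hR.2.symm) hQR
    refine (Nat.mul_le_mul_left a hle).trans ?_
    rcases Nat.eq_zero_or_pos d with h0 | h0
    · rw [h0, Nat.choose_eq_zero_of_lt (show 0 < a from ha)]
      simp
    · rw [← mul_choose_pred d a h0 ha]
      exact Nat.mul_le_mul_left _ (Nat.choose_le_choose _ (by omega))
  have hsum : ∑ A ∈ C.image Prod.fst, #(bipartiteAbove (fun A y => ∀ x ∈ A, G.Adj x y) Y A) ≤
      #Y * D.choose a := by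
    rw [sum_card_bipartiteAbove_eq_sum_card_bipartiteBelow, ← smul_eq_mul]
    refine sum_le_card_nsmul _ _ _ fun y _ => ?_
    refine le_trans ?_ (Nat.choose_le_choose a (hdeg y))
    rw [← card_powersetCard]
    refine card_le_card fun A hA => ?_
    obtain ⟨hA, hAy⟩ := mem_filter.1 hA
    obtain ⟨P, hP, rfl⟩ := mem_image.1 hA
    rw [mem_powersetCard]
    refine ⟨fun x hx => ?_, (mem_bicliques.1 (hC hP)).1.1.2⟩
    simpa using (hAy x hx).symm
  rw [card_eq_sum_card_fiberwise hmaps, mul_sum]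
  refine (sum_le_sum hfiber).trans ?_
  rw [← sum_mul]
  exact Nat.mul_le_mul_right _ hsum

theorem card_family_le_of_lt (hdeg : ∀ v, #{x | G.Adj v x} ≤ D) (haD : a ≤ D)
    (hDa : 7 * D ≤ 8 * a) (ha : 1 ≤ a) {C : Finset (Finset V × Finset V)}
    (hC : C ⊆ bicliques G S a a) (hinter : ∀ P ∈ C, ∀ Q ∈ C, (P.1 ∩ Q.1).Nonempty)
    (hY : D < #(C.biUnion Prod.snd)) : #C ≤ D.choose a * D.choose a := by
  rcases C.eq_empty_or_nonempty with rfl | ⟨P, hP⟩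
  · simp
  have hYle := card_snd_union_le hdeg hDa ha hC hinter ⟨P, hP⟩
  have hmul := mul_card_family_le hdeg ha hC hinter hY
  have hlt := card_common_lt hdeg hC hinter hY hP
  have hP' := mem_bicliques.1 (hC hP)
  have hale : a ≤ #{y ∈ C.biUnion Prod.snd | ∀ x ∈ P.1, G.Adj x y} := by
    refine hP'.1.2.2.symm.le.trans (card_le_card fun y hy => ?_)
    exact mem_filter.2 ⟨mem_biUnion.2 ⟨P, hP, hy⟩, fun x hx => hP'.2 x hx y hy⟩
  generalize #(C.biUnion Prod.snd) = y at *
  obtain ⟨E, rfl⟩ : ∃ E, D = E + 2 := ⟨D - 2, by omega⟩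
  obtain ⟨c, rfl⟩ := Nat.exists_eq_add_of_le' ha
  rw [Nat.add_sub_cancel, Nat.add_sub_cancel] at hmul
  have hid := Nat.choose_mul_succ_eq E c
  have hid' := mul_choose_pred (E + 2) (c + 1) (by omega) (by omega)
  rw [Nat.add_sub_cancel, show E + 2 - 1 = E + 1 by omega] at hid'
  -- With D = E + 2 and a = c + 1 this is |Y|(D - a) ≤ D(D - 1). It combines 6|Y| ≤ 7D with 7(D - a)
  -- ≤ 6(D - 1), which follows from 7D ≤ 8a and D ≥ 2.
  have hyb : y * (E + 1 - c) ≤ (E + 2) * (E + 1) := by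
    refine Nat.le_of_mul_le_mul_left (c := 6) ?_ (by norm_num)
    calc 6 * (y * (E + 1 - c)) = (6 * y) * (E + 1 - c) := by ring
      _ ≤ (7 * (E + 2)) * (E + 1 - c) := Nat.mul_le_mul_right _ hYle
      _ = (E + 2) * (7 * (E + 1 - c)) := by ring
      _ ≤ (E + 2) * (6 * (E + 1)) := Nat.mul_le_mul_left _ (by omega)
      _ = _ := by ring
  refine Nat.le_of_mul_le_mul_left (c := (E + 1) * (c + 1)) ?_ (by positivity)
  calc (E + 1) * (c + 1) * #C = (E + 1) * ((c + 1) * #C) := by ring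
    _ ≤ (E + 1) * (y * (E + 2).choose (c + 1) * E.choose c) := Nat.mul_le_mul_left _ hmul
    _ = y * (E + 2).choose (c + 1) * (E.choose c * (E + 1)) := by ring
    _ = (y * (E + 1 - c)) * ((E + 2).choose (c + 1) * (E + 1).choose c) := by rw [hid]; ring
    _ ≤ ((E + 2) * (E + 1)) * ((E + 2).choose (c + 1) * (E + 1).choose c) :=
        Nat.mul_le_mul_right _ hyb
    _ = (E + 1) * (E + 2).choose (c + 1) * ((E + 2) * (E + 1).choose c) := by ring
    _ = _ := by rw [hid']; ring

theorem card_bicliques_le_packedCount (hdeg : ∀ v, #{x | G.Adj v x} ≤ D) (haD : a ≤ D)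
    (hDa : 7 * D ≤ 8 * a) (ha : 1 ≤ a) (S : Finset V) :
    #(bicliques G S a a) ≤ 2 * packedCount D a #S := by
  induction S using Finset.strongInduction with
  | H S ih =>
  have hD : 1 ≤ D := ha.trans haD
  rcases (bicliques G S a a).eq_empty_or_nonempty with h | ⟨P₀, hP₀⟩
  · simp [h]
  set C := {P ∈ bicliques G S a a | (P.1 ∩ P₀.1).Nonempty} with hCdef
  have hC : C ⊆ bicliques G S a a := filter_subset _ _
  have hP₀' := mem_bicliques.1 hP₀
  have hP₀C : P₀ ∈ C := by
    rw [hCdef, mem_filter, inter_self]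
    exact ⟨hP₀, card_pos.1 (by omega)⟩
  have hinter : ∀ P ∈ C, ∀ Q ∈ C, (P.1 ∩ Q.1).Nonempty := by
    intro P hP Q hQ
    rw [hCdef, mem_filter] at hP hQ
    exact inter_fst_nonempty_trans hdeg hDa ha hP.1 hP₀ hQ.1 hP.2 (by
      rw [inter_comm]; exact hQ.2)
  have hclosed : ∀ P ∈ bicliques G S a a, ∀ Q ∈ C, (P.1 ∩ Q.1).Nonempty → P ∈ C := by
    intro P hP Q hQ h
    have hQ' := hQ
    rw [hCdef, mem_filter] at hQ ⊢
    exact ⟨hP, inter_fst_nonempty_trans hdeg hDa ha hP hQ.1 hP₀ h hQ.2⟩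
  set X := C.biUnion Prod.fst with hX
  set Y := C.biUnion Prod.snd with hY
  have hXS : X ⊆ S := biUnion_subset.2 fun P hP => (mem_bicliques.1 (hC hP)).1.1.1
  have hYS : Y ⊆ S := biUnion_subset.2 fun P hP => (mem_bicliques.1 (hC hP)).1.2.1
  have hdisj : Disjoint X Y := by
    rw [Finset.disjoint_left]
    intro v hvX hvY
    obtain ⟨P, hP, hvP⟩ := mem_biUnion.1 hvX
    obtain ⟨Q, hQ, hvQ⟩ := mem_biUnion.1 hvY
    -- A common vertex of X and Y puts a pair and its swap into one class, so the two sides of that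
    -- pair would meet.
    have hswap : Q.swap ∈ C := hclosed _ (swap_mem_bicliques (hC hQ)) P hP
      ⟨v, mem_inter.2 ⟨hvQ, hvP⟩⟩
    obtain ⟨x, hx⟩ := hinter _ hswap Q hQ
    rw [mem_inter] at hx
    exact absurd rfl ((mem_bicliques.1 (hC hQ)).2 x hx.2 x hx.1).ne
  have hCle : #C ≤ packedCount D a (#X + #Y) := by
    rcases le_or_gt #Y D with h | h
    · exact card_family_le_packedCount hdeg hD ha hC (fun P hP => subset_biUnion_of_mem _ hP)
        (fun P hP => subset_biUnion_of_mem _ hP) h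
    rcases le_or_gt #X D with h' | h'
    · rw [← card_image_of_injective C Prod.swap_injective, add_comm]
      refine card_family_le_packedCount (S := S) hdeg hD ha ?_ ?_ ?_ h'
      · intro P hP
        obtain ⟨Q, hQ, rfl⟩ := mem_image.1 hP
        exact swap_mem_bicliques (hC hQ)
      · intro P hP
        obtain ⟨Q, hQ, rfl⟩ := mem_image.1 hP
        exact subset_biUnion_of_mem Prod.snd hQ
      · intro P hP
        obtain ⟨Q, hQ, rfl⟩ := mem_image.1 hP
        exact subset_biUnion_of_mem Prod.fst hQ
    -- Here |X| + |Y| > 2D, so a full block K_{D,D} is available to absorb C(D,a)².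
    · refine (card_family_le_of_lt hdeg haD hDa ha hC hinter h).trans ?_
      rw [← balancedCount_two_mul]
      exact (balancedCount_le_packedCount hD le_rfl).trans (packedCount_mono hD ha (by omega))
  have hcover : bicliques G S a a ⊆ bicliques G (S \ (X ∪ Y)) a a ∪ (C ∪ C.image Prod.swap) := by
    intro P hP
    by_cases h : P ∈ C
    · exact mem_union_right _ (mem_union_left _ h)
    by_cases h' : P.swap ∈ C
    · exact mem_union_right _ (mem_union_right _ (mem_image.2 ⟨_, h', Prod.swap_swap P⟩))
    refine mem_union_left _ ?_
    have havoid : ∀ Q ∈ bicliques G S a a, Q ∉ C → Q.swap ∉ C → ∀ x ∈ Q.1, x ∉ X ∪ Y := by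
      intro Q hQ hQC hQC' x hx hxU
      rcases mem_union.1 hxU with hx' | hx'
      · obtain ⟨R, hR, hxR⟩ := mem_biUnion.1 hx'
        exact hQC (hclosed Q hQ R hR ⟨x, mem_inter.2 ⟨hx, hxR⟩⟩)
      · obtain ⟨R, hR, hxR⟩ := mem_biUnion.1 hx'
        have := inter_snd_nonempty hdeg hDa ha hQ (swap_mem_bicliques (hC hR))
          ⟨x, mem_inter.2 ⟨hx, hxR⟩⟩
        exact hQC' (hclosed _ (swap_mem_bicliques hQ) R hR this)
    have hP' := mem_bicliques.1 hP
    refine mem_bicliques.2 ⟨⟨⟨fun x hx => ?_, hP'.1.1.2⟩, fun x hx => ?_, hP'.1.2.2⟩, hP'.2⟩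
    · exact mem_sdiff.2 ⟨hP'.1.1.1 hx, havoid P hP h h' x hx⟩
    · exact mem_sdiff.2 ⟨hP'.1.2.1 hx, havoid P.swap (swap_mem_bicliques hP) h'
        (by rwa [Prod.swap_swap]) x hx⟩
  have hUS : X ∪ Y ⊆ S := union_subset hXS hYS
  obtain ⟨v, hv⟩ : P₀.1.Nonempty := card_pos.1 (by omega)
  have hvX : v ∈ X := mem_biUnion.2 ⟨P₀, hP₀C, hv⟩
  have hlt : S \ (X ∪ Y) ⊂ S :=
    sdiff_ssubset hUS ⟨v, mem_union_left _ hvX⟩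
  have h1 := ih _ hlt
  have h2 : #(S \ (X ∪ Y)) + (#X + #Y) = #S := by
    rw [← card_union_of_disjoint hdisj, card_sdiff_add_card_eq_card hUS]
  have h3 := packedCount_add_le hD ha #(S \ (X ∪ Y)) (#X + #Y)
  rw [h2] at h3
  have h4 := (card_le_card hcover).trans ((card_union_le _ _).trans
    (Nat.add_le_add_left (card_union_le _ _) _))
  rw [card_image_of_injective C Prod.swap_injective] at h4
  omega

theorem genEx_Kab_self_star_eq {a t n p : ℕ} (ha : 1 ≤ a) (hat : a < t)
    (ht : (t : ℝ) ≤ 8 * (a : ℝ) / 7 + 1) (hp : p = n - (2 * t - 2) * (n / (2 * t - 2))) :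
    genEx n (Kab a a) (Kab 1 t) =
      ((disjointCopies (n / (2 * t - 2)) (Kab (t - 1) (t - 1))).sum
        (Kab (p / 2) ((p + 1) / 2))).copyCount (Kab a a) := by
  obtain ⟨D, rfl⟩ : ∃ D, t = D + 1 := ⟨t - 1, by omega⟩
  have hDa : 7 * D ≤ 8 * a := by
    push_cast at ht
    have : (7 * D : ℝ) ≤ 8 * a := by linarith
    exact_mod_cast this
  rw [show 2 * (D + 1) - 2 = 2 * D by omega] at *
  rw [Nat.add_sub_cancel]
  have hpm : p = n % (2 * D) := by
    rw [hp]; have := Nat.div_add_mod n (2 * D); omega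
  have hplt : p < 2 * D := hpm ▸ Nat.mod_lt _ (by omega)
  apply le_antisymm
  · refine genEx_le fun G hG => copyCount_Kab_mono ha ha ?_
    refine le_trans (card_bicliques_le_packedCount (degree_le_pred_of_free hG) (by omega)
      (by simpa using hDa) ha univ) ?_
    refine le_trans ?_ (card_bicliques_add_le_sum _ _ ha)
    refine le_trans ?_ (Nat.add_le_add ((Nat.mul_le_mul_left _ (le_card_bicliques_Kab ha)).trans
      (mul_card_bicliques_le_disjointCopies _ _ ha)) (le_card_bicliques_Kab ha))
    unfold packedCount
    rw [card_univ, Fintype.card_fin, Nat.add_sub_cancel, balancedCount_two_mul, ← hpm]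
    unfold balancedCount
    exact le_of_eq (by ring)
  · refine copyCount_le_genEx ha ha le_rfl (by omega) ?_ (free_of_degree_lt fun v =>
      Nat.lt_succ_of_le (degree_sum_le (degree_disjointCopies_le (degree_Kab_le le_rfl le_rfl))
        (degree_Kab_le (by omega) (by omega)) v))
    simp only [Fintype.card_prod, Fintype.card_fin, Fintype.card_sum]
    have h1 := Nat.div_add_mod n (2 * D)
    have h2 : n / (2 * D) * (D + D) = 2 * D * (n / (2 * D)) := by ring
    omega

end Clusters

/-! ### Behrend-type sets in finite fields. -/

section ConvexFree
open scoped Classical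
open Finset

/-- No element of `M` is a proper convex combination of two distinct elements of `M` with
natural weights of sum at most `k`. -/
def ConvexFree {F : Type*} [Ring F] (k : ℕ) (M : Finset F) : Prop :=
  ∀ x ∈ M, ∀ y ∈ M, ∀ z ∈ M, ∀ r s : ℕ, 1 ≤ r → 1 ≤ s → r + s ≤ k →
    (r : F) * x + (s : F) * y = ((r + s : ℕ) : F) * z → x = y

/-- Strict convexity of a sphere, by the identity rs(x-y)² = (r+s)(rx²+sy²) - (rx+sy)² summed over
the coordinates. -/
theorem eq_of_convex_comb_of_sum_sq_eq {ι : Type*} [Fintype ι] {x y z : ι → ℕ} {r s R : ℕ}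
    (hr : 1 ≤ r) (hs : 1 ≤ s) (hx : ∑ i, x i ^ 2 = R) (hy : ∑ i, y i ^ 2 = R)
    (hz : ∑ i, z i ^ 2 = R) (h : ∀ i, r * x i + s * y i = (r + s) * z i) : x = y := by
  have hpt : ∀ i, (r * s : ℤ) * ((x i : ℤ) - y i) ^ 2 =
      (r + s) * (r * (x i : ℤ) ^ 2 + s * (y i : ℤ) ^ 2) - (r + s) ^ 2 * (z i : ℤ) ^ 2 := by
    intro i
    have h' : (r * x i + s * y i : ℤ) = (r + s) * z i := by exact_mod_cast h i
    rw [← mul_pow, ← h']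
    ring
  have hx' : ∑ i, (x i : ℤ) ^ 2 = R := by exact_mod_cast hx
  have hy' : ∑ i, (y i : ℤ) ^ 2 = R := by exact_mod_cast hy
  have hz' : ∑ i, (z i : ℤ) ^ 2 = R := by exact_mod_cast hz
  have hsum : ∑ i, (r * s : ℤ) * ((x i : ℤ) - y i) ^ 2 = 0 := by
    rw [sum_congr rfl fun i _ => hpt i, sum_sub_distrib, ← mul_sum, ← mul_sum, sum_add_distrib,
      ← mul_sum, ← mul_sum, hx', hy', hz']
    ring
  rw [sum_eq_zero_iff_of_nonneg fun i _ => by positivity] at hsum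
  funext i
  have h0 := hsum i (mem_univ i)
  have hrs : (r * s : ℤ) ≠ 0 := by positivity
  have := pow_eq_zero_iff (two_ne_zero) |>.1 ((mul_eq_zero.1 h0).resolve_left hrs)
  omega

/-- Behrend's construction: vectors in {0, …, L-1}^d on the most popular of at most dL² + 1 spheres,
read in F_p^d ≅ F_{p^d}. Because kL ≤ p, combinations of total weight at most k do not wrap around
modulo p, so field relations lift to the integers. -/
theorem exists_convexFree (p d k L : ℕ) [Fact p.Prime] (hd : d ≠ 0) (hk : 1 ≤ k)
    (hL : k * L ≤ p) : ∃ M : Finset (GaloisField p d), ConvexFree k M ∧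
      L ^ d ≤ (d * L ^ 2 + 1) * #M := by
  let S : Finset (Fin d → ℕ) := Fintype.piFinset fun _ => range L
  have hS : #S = L ^ d := by simp [S]
  have hmemS : ∀ {x}, x ∈ S → ∀ i, x i < L := fun {x} hx i =>
    mem_range.1 (Fintype.mem_piFinset.1 hx i)
  have hmaps : ∀ x ∈ S, ∑ i, x i ^ 2 ∈ range (d * L ^ 2 + 1) := by
    intro x hx
    rw [mem_range, Nat.lt_succ_iff]
    refine (sum_le_card_nsmul univ _ (L ^ 2) fun i _ =>
      Nat.pow_le_pow_left (hmemS hx i).le 2).trans ?_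
    simp
  obtain ⟨R, -, hmax⟩ := exists_max_image (range (d * L ^ 2 + 1))
    (fun R => #{x ∈ S | ∑ i, x i ^ 2 = R}) ⟨0, by simp⟩
  have hcard := card_le_mul_card_image_of_maps_to hmaps _ hmax
  rw [hS, card_range, mul_comm] at hcard
  let e : GaloisField p d ≃ₗ[ZMod p] (Fin d → ZMod p) :=
    LinearEquiv.ofFinrankEq _ _ (by rw [GaloisField.finrank p hd, Module.finrank_fin_fun])
  let φ : (Fin d → ℕ) → GaloisField p d := fun x => e.symm fun i => (x i : ZMod p)
  have hLp : L ≤ p := (Nat.le_mul_of_pos_left L hk).trans hL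
  have hcast : ∀ {m n : ℕ}, m < p → n < p → (m : ZMod p) = n → m = n := by
    intro m n hm hn h
    rwa [ZMod.natCast_eq_natCast_iff', Nat.mod_eq_of_lt hm, Nat.mod_eq_of_lt hn] at h
  have hφ : Set.InjOn φ ({x ∈ S | ∑ i, x i ^ 2 = R} : Finset _) := by
    intro x hx y hy hxy
    rw [mem_coe, mem_filter] at hx hy
    funext i
    exact hcast ((hmemS hx.1 i).trans_le hLp) ((hmemS hy.1 i).trans_le hLp)
      (congrFun (e.symm.injective hxy) i)
  have hφe : ∀ x i, e (φ x) i = (x i : ZMod p) := fun x i => congrFun (e.apply_symm_apply _) i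
  refine ⟨({x ∈ S | ∑ i, x i ^ 2 = R} : Finset _).image φ, ?_, ?_⟩
  · intro X hX Y hY Z hZ r s hr hs hrs h
    obtain ⟨x, hx, rfl⟩ := mem_image.1 hX
    obtain ⟨y, hy, rfl⟩ := mem_image.1 hY
    obtain ⟨z, hz, rfl⟩ := mem_image.1 hZ
    rw [mem_filter] at hx hy hz
    refine congrArg φ (eq_of_convex_comb_of_sum_sq_eq hr hs hx.2 hy.2 hz.2 fun i => ?_)
    rw [← nsmul_eq_mul, ← nsmul_eq_mul, ← nsmul_eq_mul] at h
    have h' := congrFun (congrArg e h) i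
    rw [map_add, map_nsmul, map_nsmul, map_nsmul, Pi.add_apply, Pi.smul_apply, Pi.smul_apply,
      Pi.smul_apply, hφe, hφe, hφe, nsmul_eq_mul, nsmul_eq_mul, nsmul_eq_mul] at h'
    have hlt : ∀ u v : ℕ, u < L → v < L → r * u + s * v < p := by
      intro u v hu hv
      calc r * u + s * v < r * L + s * L :=
            Nat.add_lt_add (Nat.mul_lt_mul_of_pos_left hu hr) (Nat.mul_lt_mul_of_pos_left hv hs)
        _ = (r + s) * L := by ring
        _ ≤ k * L := Nat.mul_le_mul_right _ hrs
        _ ≤ p := hL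
    refine hcast (hlt _ _ (hmemS hx.1 i) (hmemS hy.1 i)) ?_ (by push_cast at h' ⊢; exact h')
    rw [add_mul]
    exact hlt _ _ (hmemS hz.1 i) (hmemS hz.1 i)
  · rwa [card_image_of_injOn hφ]

/-- If x ≠ x', dividing the second difference relation by the first yields x + x' = y + y', hence
2cx = (c+d)y + (c-d)y'. According to the sign of c - d this is a convex relation between points of
M, of total weight at most 2K, or the excluded equality x = y. -/
theorem ConvexFree.eq_of_moment_eq {F : Type*} [Field F] {K : ℕ} {M : Finset F}
    (hM : ConvexFree (2 * K) M) (hK : ∀ k : ℕ, 1 ≤ k → k ≤ 2 * K → (k : F) ≠ 0) {c d : ℕ}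
    (hc : 1 ≤ c) (hcK : c ≤ K) (hd : 1 ≤ d) (hdK : d ≤ K) {x x' y y' : F} (hx : x ∈ M)
    (hy : y ∈ M) (hy' : y' ∈ M) (h1 : (c : F) * x - d * y = c * x' - d * y')
    (h2 : (c : F) * x ^ 2 - d * y ^ 2 = c * x' ^ 2 - d * y' ^ 2) (hcd : c = d → x ≠ y) :
    x = x' := by
  by_contra hne
  have hc0 : (c : F) ≠ 0 := hK c hc (by omega)
  have hsum : x + x' = y + y' := by
    have h3 : (c : F) * (x - x') * (x + x' - (y + y')) = 0 := by
      linear_combination h2 - (y + y') * h1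
    have := (mul_eq_zero.1 h3).resolve_left (mul_ne_zero hc0 (sub_ne_zero.2 hne))
    exact sub_eq_zero.1 this
  have hrel : (2 * c : F) * x = (c + d) * y + (c - d) * y' := by
    linear_combination h1 + c * hsum
  rcases lt_trichotomy c d with h | rfl | h
  · obtain ⟨e, rfl⟩ := Nat.exists_eq_add_of_lt h
    have hxy : x = y' := by
      refine hM x hx y' hy' y hy (2 * c) (e + 1) (by omega) (by omega) (by omega) ?_
      push_cast at hrel ⊢
      linear_combination hrel
    have hx'y : x' = y := by linear_combination hsum - hxy
    have h3 : ((c + (c + e + 1) : ℕ) : F) * (x - x') = 0 := by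
      rw [← hxy, ← hx'y] at h1
      push_cast at h1 ⊢
      linear_combination h1
    exact hne (sub_eq_zero.1 ((mul_eq_zero.1 h3).resolve_left (hK _ (by omega) (by omega))))
  · refine hcd rfl ?_
    have h3 : ((2 * c : ℕ) : F) * (x - y) = 0 := by
      push_cast
      linear_combination hrel
    exact sub_eq_zero.1 ((mul_eq_zero.1 h3).resolve_left (hK _ (by omega) (by omega)))
  · obtain ⟨e, rfl⟩ := Nat.exists_eq_add_of_lt h
    have hyy : y = y' := by
      refine hM y hy y' hy' x hx (2 * d + e + 1) (e + 1) (by omega) (by omega) (by omega) ?_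
      push_cast at hrel ⊢
      linear_combination -hrel
    have h3 : ((d + e + 1 : ℕ) : F) * (x - x') = 0 := by
      rw [hyy] at h1
      linear_combination h1
    exact hne (sub_eq_zero.1 ((mul_eq_zero.1 h3).resolve_left hc0))

end ConvexFree

/-! ### The graph on translates of the moment curve. -/

section MomentGraph
open scoped Classical
open Finset

/-- The bipartite graph of a relation. -/
def bipartiteOfRel {α β : Type*} (r : α → β → Prop) : SimpleGraph (α ⊕ β) where
  Adj
    | .inl x, .inr y => r x y
    | .inr y, .inl x => r x y
    | _, _ => False
  symm := ⟨fun x y h => by rcases x with x | x <;> rcases y with y | y <;> exact h⟩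
  loopless := ⟨fun x h => by rcases x with x | x <;> exact h⟩

section Adj
variable {α β : Type*} {r : α → β → Prop}

@[simp]
theorem bipartiteOfRel_adj_inl_inr {x : α} {y : β} :
    (bipartiteOfRel r).Adj (.inl x) (.inr y) ↔ r x y := Iff.rfl

@[simp]
theorem bipartiteOfRel_adj_inr_inl {x : α} {y : β} :
    (bipartiteOfRel r).Adj (.inr y) (.inl x) ↔ r x y := Iff.rfl

@[simp]
theorem not_bipartiteOfRel_adj_inl_inl {x x' : α} :
    ¬ (bipartiteOfRel r).Adj (.inl x) (.inl x') := id

@[simp]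
theorem not_bipartiteOfRel_adj_inr_inr {y y' : β} :
    ¬ (bipartiteOfRel r).Adj (.inr y) (.inr y') := id

end Adj

/-- The graph is free of `K_{s,t}` when two points on one side have at most one common neighbour
of each of fewer than `t` colours on the other side. -/
theorem bipartiteOfRel_free {α β ι κ : Type*} [Fintype α] [Fintype β] [Fintype ι] [Fintype κ]
    {r : α → β → Prop} (f : α → ι) (g : β → κ) {s t : ℕ} (hs : 2 ≤ s)
    (hι : Fintype.card ι < t) (hκ : Fintype.card κ < t)
    (hl : ∀ x x' y y', x ≠ x' → r x y → r x' y → r x y' → r x' y' → g y = g y' → y = y')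
    (hr : ∀ y y' x x', y ≠ y' → r x y → r x y' → r x' y → r x' y' → f x = f x' → x = x') :
    (Kab s t).Free (bipartiteOfRel r) := by
  refine free_of_common_lt fun A hA => ?_
  obtain ⟨u, hu, v, hv, huv⟩ := one_lt_card.1 (show 1 < #A by omega)
  refine lt_of_le_of_lt (card_le_card (t := ({w | (bipartiteOfRel r).Adj u w ∧
    (bipartiteOfRel r).Adj v w} : Finset (α ⊕ β))) fun w hw => ?_) ?_
  · simp only [mem_filter, mem_univ, true_and] at hw ⊢
    exact ⟨hw u hu, hw v hv⟩
  rcases u with x | y <;> rcases v with x' | y'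
  · refine lt_of_le_of_lt ?_ hκ
    -- `none` is a default colour for the side that contains no common neighbour.
    rw [← card_univ, ← card_map (.some : κ ↪ Option κ)]
    refine card_le_card_of_injOn (Sum.elim (fun _ => none) fun y => some (g y)) ?_ ?_
    · rintro (w | w) hw <;> simp at hw ⊢
    · rintro (w | w) hw (w' | w') hw' h <;> simp at hw hw' h ⊢
      exact hl x x' w w' (by simpa using huv) hw.1 hw.2 hw'.1 hw'.2 h
  · refine lt_of_eq_of_lt (card_eq_zero.2 (filter_eq_empty_iff.2 ?_)) (by omega)
    rintro (w | w) - hw <;> simp at hw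
  · refine lt_of_eq_of_lt (card_eq_zero.2 (filter_eq_empty_iff.2 ?_)) (by omega)
    rintro (w | w) - hw <;> simp at hw
  · refine lt_of_le_of_lt ?_ hι
    rw [← card_univ, ← card_map (.some : ι ↪ Option ι)]
    refine card_le_card_of_injOn (Sum.elim (fun x => some (f x)) fun _ => none) ?_ ?_
    · rintro (w | w) hw <;> simp at hw ⊢
    · rintro (w | w) hw (w' | w') hw' h <;> simp at hw hw' h ⊢
      exact hr y y' w w' (by simpa using huv) hw.1 hw.2 hw'.1 hw'.2 h

variable {F : Type*} [Field F]

/-- Points of `F²` in `a` left and `b` right classes, where a point of class `i` on the left is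
joined to its translates by `(a + j - i) • (m, m²)` of class `j` on the right. -/
def momentRel (a b : ℕ) (M : Finset F) (u : Fin a × F × F) (w : Fin b × F × F) : Prop :=
  ∃ m ∈ M, w.2.1 = u.2.1 + ((a + w.1 - u.1 : ℕ) : F) * m ∧
    w.2.2 = u.2.2 + ((a + w.1 - u.1 : ℕ) : F) * m ^ 2

/-- Two common neighbours in one class give two solutions of c(m, m²) - d(n, n²) = constant, with 1
≤ c, d ≤ a + b. The case c = d, m = n would make the two original vertices equal. -/
theorem momentRel_free [Fintype F] {a b s t : ℕ} {M : Finset F}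
    (hM : ConvexFree (2 * (a + b)) M)
    (hK : ∀ k : ℕ, 1 ≤ k → k ≤ 2 * (a + b) → (k : F) ≠ 0) (hs : 2 ≤ s) (hab : a ≤ b)
    (hbt : b < t) : (Kab s t).Free (bipartiteOfRel (momentRel a b M)) := by
  refine bipartiteOfRel_free Prod.fst Prod.fst hs (by simpa using by omega) (by simpa) ?_ ?_
  · rintro ⟨i, u1, u2⟩ ⟨i', v1, v2⟩ ⟨j, w1, w2⟩ ⟨j', z1, z2⟩ hne ⟨m, hm, e1, e2⟩
      ⟨n, hn, f1, f2⟩ ⟨m', hm', e1', e2'⟩ ⟨n', hn', f1', f2'⟩ (rfl : j = j')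
    dsimp only at e1 e2 f1 f2 e1' e2' f1' f2'
    have hi := i.2
    have hi' := i'.2
    have hj := j.2
    have hmm : m = m' := by
      refine hM.eq_of_moment_eq hK (c := a + j - i) (d := a + j - i') (by omega) (by omega)
        (by omega) (by omega) hm hn hn' ?_ ?_ ?_
      · linear_combination f1 - e1 - f1' + e1'
      · linear_combination f2 - e2 - f2' + e2'
      · intro hcd hmn
        subst hmn
        rw [← hcd] at f1 f2
        refine hne (Prod.ext (Fin.ext (by dsimp only; omega)) (Prod.ext ?_ ?_))
        · dsimp only; linear_combination f1 - e1
        · dsimp only; linear_combination f2 - e2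
    subst hmm
    exact Prod.ext rfl (Prod.ext (e1.trans e1'.symm) (e2.trans e2'.symm))
  · rintro ⟨j, w1, w2⟩ ⟨j', z1, z2⟩ ⟨i, u1, u2⟩ ⟨i', v1, v2⟩ hne ⟨m, hm, e1, e2⟩
      ⟨n, hn, f1, f2⟩ ⟨m', hm', e1', e2'⟩ ⟨n', hn', f1', f2'⟩ (rfl : i = i')
    dsimp only at e1 e2 f1 f2 e1' e2' f1' f2'
    have hi := i.2
    have hj' := j'.2
    have hj := j.2
    have hmm : m = m' := by
      refine hM.eq_of_moment_eq hK (c := a + j - i) (d := a + j' - i) (by omega) (by omega)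
        (by omega) (by omega) hm hn hn' ?_ ?_ ?_
      · linear_combination f1 - e1 - f1' + e1'
      · linear_combination f2 - e2 - f2' + e2'
      · intro hcd hmn
        subst hmn
        rw [← hcd] at f1 f2
        refine hne (Prod.ext (Fin.ext (by dsimp only; omega)) (Prod.ext ?_ ?_))
        · dsimp only; linear_combination e1 - f1
        · dsimp only; linear_combination e2 - f2
    subst hmm
    refine Prod.ext rfl (Prod.ext ?_ ?_)
    · dsimp only; linear_combination e1' - e1
    · dsimp only; linear_combination e2' - e2

/-- Left class i takes the term i of the progression and right class j the term a + j, so their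
difference is (a + j - i)(m, m²). The term 0 recovers the starting point, and the term a then
recovers m because a ≠ 0 in F. -/
theorem le_card_bicliques_momentRel [Fintype F] {a b : ℕ} {M : Finset F} (ha : 1 ≤ a)
    (hb : 1 ≤ b) (ha0 : (a : F) ≠ 0) : Fintype.card F ^ 2 * #M ≤
      #(bicliques (bipartiteOfRel (momentRel a b M)) univ a b) := by
  have hcard : #((univ : Finset (F × F)) ×ˢ M) = Fintype.card F ^ 2 * #M := by
    rw [card_product, card_univ, Fintype.card_prod, sq]
  rw [← hcard]
  let A : (F × F) × F → Finset ((Fin a × F × F) ⊕ (Fin b × F × F)) := fun q =>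
    univ.map ⟨fun i => .inl (i, q.1.1 + (i : ℕ) * q.2, q.1.2 + (i : ℕ) * q.2 ^ 2),
      fun i i' h => (Prod.ext_iff.1 (Sum.inl_injective h)).1⟩
  let B : (F × F) × F → Finset ((Fin a × F × F) ⊕ (Fin b × F × F)) := fun q =>
    univ.map ⟨fun j => .inr (j, q.1.1 + (a + (j : ℕ)) * q.2, q.1.2 + (a + (j : ℕ)) * q.2 ^ 2),
      fun i i' h => (Prod.ext_iff.1 (Sum.inr_injective h)).1⟩
  refine card_le_card_of_injOn (fun q => (A q, B q)) ?_ ?_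
  · rintro ⟨⟨x1, x2⟩, m⟩ hq
    have hm := (mem_product.1 (mem_coe.1 hq)).2
    refine mem_coe.2 (mem_bicliques.2 ⟨⟨⟨subset_univ _, by simp [A]⟩, subset_univ _,
      by simp [B]⟩, ?_⟩)
    intro u hu w hw
    obtain ⟨i, -, rfl⟩ := Finset.mem_map.1 hu
    obtain ⟨j, -, rfl⟩ := Finset.mem_map.1 hw
    refine ⟨m, hm, ?_, ?_⟩
    · dsimp only
      rw [Nat.cast_sub (by omega)]
      push_cast
      ring
    · dsimp only
      rw [Nat.cast_sub (by omega)]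
      push_cast
      ring
  · rintro ⟨⟨x1, x2⟩, m⟩ hq ⟨⟨y1, y2⟩, n⟩ hq' h
    have hA : A ((x1, x2), m) = A ((y1, y2), n) := congrArg Prod.fst h
    have hB : B ((x1, x2), m) = B ((y1, y2), n) := congrArg Prod.snd h
    have hx : (.inl (⟨0, ha⟩, x1, x2) : (Fin a × F × F) ⊕ (Fin b × F × F)) ∈
        A ((x1, x2), m) := Finset.mem_map.2 ⟨⟨0, ha⟩, mem_univ _, by
          refine congrArg Sum.inl (Prod.ext rfl (Prod.ext ?_ ?_)) <;> simp⟩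
    rw [hA] at hx
    obtain ⟨i, -, hi⟩ := Finset.mem_map.1 hx
    have hi := Sum.inl_injective hi
    simp only [Prod.mk.injEq] at hi
    obtain ⟨rfl, h1, h2⟩ := hi
    have hw : (.inr (⟨0, hb⟩, x1 + a * m, x2 + a * m ^ 2) :
        (Fin a × F × F) ⊕ (Fin b × F × F)) ∈ B ((x1, x2), m) :=
      Finset.mem_map.2 ⟨⟨0, hb⟩, mem_univ _, by
        refine congrArg Sum.inr (Prod.ext rfl (Prod.ext ?_ ?_)) <;> simp⟩
    rw [hB] at hw
    obtain ⟨j, -, hj⟩ := Finset.mem_map.1 hw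
    have hj := Sum.inr_injective hj
    simp only [Prod.mk.injEq] at hj
    obtain ⟨rfl, h3, -⟩ := hj
    simp only [Nat.cast_zero, zero_mul, add_zero] at h1 h2 h3
    subst h1 h2
    have hmn : n = m := mul_left_cancel₀ ha0 (add_left_cancel h3)
    rw [hmn]

theorem mul_pow_le_genEx {a b s t : ℕ} (hs : 2 ≤ s) (ha : 1 ≤ a) (hab : a ≤ b) (hbt : b < t)
    {p d L n : ℕ} (hp : p.Prime) (hd : d ≠ 0) (hpK : 2 * (a + b) < p)
    (hL : 2 * (a + b) * L ≤ p) (hn : (a + b) * p ^ (2 * d) ≤ n) :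
    p ^ (2 * d) * L ^ d ≤ 2 * (d * L ^ 2 + 1) * genEx n (Kab a b) (Kab s t) := by
  have : Fact p.Prime := ⟨hp⟩
  obtain ⟨M, hM, hcard⟩ := exists_convexFree p d (2 * (a + b)) L hd (by omega) hL
  let _ : Fintype (GaloisField p d) := Fintype.ofFinite _
  have hF : Fintype.card (GaloisField p d) = p ^ d := by
    rw [← Nat.card_eq_fintype_card, GaloisField.card p d hd]
  have hK : ∀ k : ℕ, 1 ≤ k → k ≤ 2 * (a + b) → (k : GaloisField p d) ≠ 0 := by
    intro k hk hk' h0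
    rw [CharP.cast_eq_zero_iff (GaloisField p d) p] at h0
    exact absurd (Nat.le_of_dvd hk h0) (by omega)
  have hb : 1 ≤ b := ha.trans hab
  have hfree := momentRel_free hM hK hs hab hbt
  have hbic := le_card_bicliques_momentRel (M := M) ha hb (hK a ha (by omega))
  have hle : (bipartiteOfRel (momentRel a b M)).copyCount (Kab a b) ≤
      genEx n (Kab a b) (Kab s t) := by
    refine copyCount_le_genEx ha hb (by omega) (by omega) ?_ hfree
    simp only [Fintype.card_sum, Fintype.card_prod, Fintype.card_fin, hF]
    refine le_trans (le_of_eq ?_) hn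
    ring
  rw [← copyCount_Kab _ ha hb, hF] at hbic
  have htwo : (if a = b then 2 else 1) ≤ 2 := by split_ifs <;> norm_num
  calc p ^ (2 * d) * L ^ d ≤ p ^ (2 * d) * ((d * L ^ 2 + 1) * #M) := Nat.mul_le_mul_left _ hcard
    _ = (d * L ^ 2 + 1) * ((p ^ d) ^ 2 * #M) := by ring
    _ ≤ (d * L ^ 2 + 1) * (genEx n (Kab a b) (Kab s t) * 2) :=
        Nat.mul_le_mul_left _ (hbic.trans (Nat.mul_le_mul hle htwo))
    _ = _ := by ring

end MomentGraph

/-! ### Choice of the prime and the passage to n^{3/2 - o(1)}; part (iii). -/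

section Asymptotic

/-- Put d = e + 2. With L of order p, |M| has order at least p^{d-2}, so about p^{2d} vertices carry
p^{3d-2} = p^{3e+4} copies: the exponent in n is 3/2 - 1/d. -/
theorem exists_pow_le_mul_genEx_pow {a b s t : ℕ} (hs : 2 ≤ s) (ha : 1 ≤ a) (hab : a ≤ b)
    (hbt : b < t) (e : ℕ) : ∃ C : ℕ, 0 < C ∧ ∀ᶠ n : ℕ in atTop,
      n ^ (3 * e + 4) ≤ C * genEx n (Kab a b) (Kab s t) ^ (2 * (e + 2)) := by
  set K := a + b with hK
  have hK0 : 0 < K := by omega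
  refine ⟨(K * 2 ^ (2 * (e + 2))) ^ (3 * e + 4) * ((4 * K) ^ e * (2 * (e + 3))) ^ (2 * (e + 2)),
    by positivity, ?_⟩
  filter_upwards [eventually_ge_atTop (K * (4 * K + 1) ^ (2 * (e + 2)))] with n hn
  set N := Nat.findGreatest (fun N => K * N ^ (2 * (e + 2)) ≤ n) n with hN
  have hbase : 4 * K + 1 ≤ n := by
    refine le_trans ?_ hn
    calc 4 * K + 1 ≤ (4 * K + 1) ^ (2 * (e + 2)) := Nat.le_self_pow (by omega) _
      _ ≤ _ := Nat.le_mul_of_pos_left _ hK0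
  have hNge : 4 * K + 1 ≤ N := Nat.le_findGreatest hbase hn
  have hNle : K * N ^ (2 * (e + 2)) ≤ n :=
    Nat.findGreatest_spec (P := fun N => K * N ^ (2 * (e + 2)) ≤ n) hbase hn
  have hNlt : n < K * (N + 1) ^ (2 * (e + 2)) := by
    by_contra hcon
    push Not at hcon
    have hle : N + 1 ≤ n := by
      refine le_trans (le_trans (Nat.le_self_pow (n := 2 * (e + 2)) (by omega) _) ?_) hcon
      exact Nat.le_mul_of_pos_left _ hK0
    have := Nat.le_findGreatest (P := fun N => K * N ^ (2 * (e + 2)) ≤ n) hle hcon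
    omega
  -- Bertrand's postulate gives N/2 < p ≤ N; N ≥ 4K + 1 ensures p > 2K, and N + 1 ≤ 2p keeps p^{2d}
  -- within a constant factor of n.
  obtain ⟨p, hp, hp1, hp2⟩ := Nat.exists_prime_lt_and_le_two_mul (N / 2) (by omega)
  have hL1 : 1 ≤ p / (2 * K) := (Nat.le_div_iff_mul_le (by omega)).2 (by omega)
  have hLp : 2 * K * (p / (2 * K)) ≤ p := Nat.mul_div_le _ _
  have hpL : p ≤ 4 * K * (p / (2 * K)) := by
    have h1 := Nat.div_add_mod p (2 * K)
    have h2 := Nat.mod_lt p (show 0 < 2 * K by omega)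
    have h3 : 2 * K ≤ 2 * K * (p / (2 * K)) := Nat.le_mul_of_pos_right _ hL1
    have h4 : 4 * K * (p / (2 * K)) = 2 * K * (p / (2 * K)) + 2 * K * (p / (2 * K)) := by ring
    omega
  generalize p / (2 * K) = L at *
  have hmain := mul_pow_le_genEx hs ha hab hbt (d := e + 2) (L := L) (n := n) hp (by omega)
    (by omega) (by simpa [← hK] using hLp)
    (le_trans (Nat.mul_le_mul_left _ (Nat.pow_le_pow_left (show p ≤ N by omega) _)) hNle)
  generalize genEx n (Kab a b) (Kab s t) = g at *
  have hg1 : p ^ (2 * (e + 2)) * L ^ e ≤ 2 * (e + 3) * g := by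
    refine Nat.le_of_mul_le_mul_left (c := L ^ 2) ?_ (by positivity)
    calc L ^ 2 * (p ^ (2 * (e + 2)) * L ^ e) = p ^ (2 * (e + 2)) * L ^ (e + 2) := by ring
      _ ≤ 2 * ((e + 2) * L ^ 2 + 1) * g := hmain
      _ ≤ 2 * ((e + 2) * L ^ 2 + L ^ 2) * g :=
        Nat.mul_le_mul_right _ (Nat.mul_le_mul_left _ (Nat.add_le_add_left
          (Nat.one_le_pow _ _ hL1) _))
      _ = _ := by ring
  have hg2 : p ^ (3 * e + 4) ≤ (4 * K) ^ e * (2 * (e + 3)) * g := by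
    calc p ^ (3 * e + 4) = p ^ (2 * (e + 2)) * p ^ e := by ring
      _ ≤ p ^ (2 * (e + 2)) * (4 * K * L) ^ e :=
        Nat.mul_le_mul_left _ (Nat.pow_le_pow_left hpL _)
      _ = (4 * K) ^ e * (p ^ (2 * (e + 2)) * L ^ e) := by rw [mul_pow]; ring
      _ ≤ (4 * K) ^ e * (2 * (e + 3) * g) := Nat.mul_le_mul_left _ hg1
      _ = _ := by ring
  have hnp : n ≤ K * 2 ^ (2 * (e + 2)) * p ^ (2 * (e + 2)) := by
    refine hNlt.le.trans ?_
    rw [mul_assoc, ← mul_pow]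
    exact Nat.mul_le_mul_left _ (Nat.pow_le_pow_left (by omega) _)
  calc n ^ (3 * e + 4) ≤ (K * 2 ^ (2 * (e + 2)) * p ^ (2 * (e + 2))) ^ (3 * e + 4) :=
        Nat.pow_le_pow_left hnp _
    _ = (K * 2 ^ (2 * (e + 2))) ^ (3 * e + 4) * (p ^ (3 * e + 4)) ^ (2 * (e + 2)) := by
        rw [mul_pow, ← pow_mul, ← pow_mul, mul_comm (3 * e + 4)]
    _ ≤ (K * 2 ^ (2 * (e + 2))) ^ (3 * e + 4) *
          ((4 * K) ^ e * (2 * (e + 3)) * g) ^ (2 * (e + 2)) :=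
        Nat.mul_le_mul_left _ (Nat.pow_le_pow_left hg2 _)
    _ = _ := by rw [mul_pow ((4 * K) ^ e * (2 * (e + 3))), mul_assoc]

/-- A sequence that is at least a constant times `n ^ (3 / 2 - 1 / d)` for each integer `d ≥ 2` is
`Ω(n ^ (3 / 2 - o(1)))`. -/
theorem exists_isBigO_of_pow_le {g : ℕ → ℕ}
    (h : ∀ e : ℕ, ∃ C : ℕ, 0 < C ∧ ∀ᶠ n : ℕ in atTop,
      n ^ (3 * e + 4) ≤ C * g n ^ (2 * (e + 2))) :
    ∃ ε : ℕ → ℝ, Tendsto ε atTop (𝓝 0) ∧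
      (fun n : ℕ => (n : ℝ) ^ ((3 : ℝ) / 2 - ε n)) =O[atTop] (fun n : ℕ => (g n : ℝ)) := by
  have hpos : ∀ᶠ n : ℕ in atTop, 1 ≤ g n := by
    obtain ⟨C, -, hC⟩ := h 0
    filter_upwards [hC, eventually_ge_atTop 1] with n hn hn1
    by_contra hcon
    have h0 : g n = 0 := by omega
    have h4 : n ^ 4 ≤ 0 := by simpa [h0] using hn
    have := Nat.one_le_pow 4 n hn1
    omega
  -- This ε is the exact deficit of the exponent of g(n), truncated at 0, so n^{3/2 - ε} ≤ g(n)
  -- holds eventually with constant 1.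
  refine ⟨fun n => max 0 (3 / 2 - Real.log (g n) / Real.log n), ?_, ?_⟩
  · rw [tendsto_order]
    refine ⟨fun c hc => Eventually.of_forall fun n => lt_max_of_lt_left hc, fun c hc => ?_⟩
    obtain ⟨e, he⟩ := exists_nat_gt (2 / c)
    obtain ⟨C, hC0, hC⟩ := h e
    have hlog : ∀ᶠ n : ℕ in atTop, Real.log C / c < Real.log n :=
      (Real.tendsto_log_atTop.comp tendsto_natCast_atTop_atTop).eventually_gt_atTop _
    filter_upwards [hC, hpos, eventually_ge_atTop 2, hlog] with n hn hg hn2 hnlog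
    refine max_lt hc ?_
    have hn0 : (0 : ℝ) < Real.log n := Real.log_pos (by exact_mod_cast hn2)
    have hC0' : (0 : ℝ) < C := by exact_mod_cast hC0
    have hg' : (0 : ℝ) < g n := by exact_mod_cast hg
    have hn' : (0 : ℝ) < n := by exact_mod_cast (by omega : 0 < n)
    have hreal : (n : ℝ) ^ (3 * e + 4) ≤ C * (g n : ℝ) ^ (2 * (e + 2)) := by exact_mod_cast hn
    have hl := Real.log_le_log (by positivity) hreal
    rw [Real.log_mul hC0'.ne' (by positivity), Real.log_pow, Real.log_pow] at hl
    push_cast at hl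
    rw [div_lt_iff₀ hc] at he hnlog
    rw [sub_lt_iff_lt_add, ← sub_lt_iff_lt_add', lt_div_iff₀ hn0]
    have he0 : (0 : ℝ) ≤ e := Nat.cast_nonneg e
    have h1 : 2 * Real.log n ≤ e * c * Real.log n := mul_le_mul_of_nonneg_right he.le hn0.le
    have h2 : (3 / 2 - c) * Real.log n * (2 * (e + 2)) < Real.log (g n) * (2 * (e + 2)) := by
      have h3 : 0 < c * Real.log n := mul_pos hc hn0
      nlinarith
    exact lt_of_mul_lt_mul_right h2 (by positivity)
  · refine IsBigO.of_bound 1 ?_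
    filter_upwards [hpos, eventually_ge_atTop 2] with n hg hn2
    have hn1 : (1 : ℝ) < n := by exact_mod_cast hn2
    have hn0 : (0 : ℝ) < Real.log n := Real.log_pos hn1
    have hg' : (0 : ℝ) < g n := by exact_mod_cast hg
    rw [one_mul, Real.norm_of_nonneg (by positivity), Real.norm_of_nonneg hg'.le]
    calc (n : ℝ) ^ ((3 : ℝ) / 2 - max 0 (3 / 2 - Real.log (g n) / Real.log n))
        ≤ (n : ℝ) ^ (Real.log (g n) / Real.log n) := by
          refine Real.rpow_le_rpow_of_exponent_le hn1.le ?_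
          have := le_max_right 0 (3 / 2 - Real.log (g n) / Real.log n)
          linarith
      _ = g n := by
          rw [Real.rpow_def_of_pos (by linarith), mul_div_cancel₀ _ hn0.ne', Real.exp_log hg']

end Asymptotic

theorem theorem3 :
    -- (i): upper bounds, and the exact value when `2t - 2` divides `n`
    ((∀ a b t n : ℕ, 1 ≤ a → a < b → b < t →
        (genEx n (Kab a b) (Kab 1 t) : ℝ) ≤
          (n : ℝ) / ((a : ℝ) + (b : ℝ)) *
            (((t - 1).choose a : ℝ) * ((t - 1).choose (b - 1) : ℝ) +
              ((t - 1).choose b : ℝ) * ((t - 1).choose (a - 1) : ℝ))) ∧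
      (∀ a t n : ℕ, 1 ≤ a → a < t →
        (genEx n (Kab a a) (Kab 1 t) : ℝ) ≤
          (n : ℝ) / (2 * (a : ℝ)) *
            (((t - 1).choose a : ℝ) * ((t - 1).choose (a - 1) : ℝ))) ∧
      (∀ a b t n : ℕ, 1 ≤ a → a ≤ b → b < t → 2 * t - 2 ∣ n →
        genEx n (Kab a b) (Kab 1 t) =
          (disjointCopies (n / (2 * t - 2)) (Kab (t - 1) (t - 1))).copyCount (Kab a b))) ∧
    -- (ii): the exact value of `ex(n, K_{a,a}, K_{1,t})` for `a < t ≤ 8a/7 + 1`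
    (∀ a t n p : ℕ, 1 ≤ a → a < t → (t : ℝ) ≤ 8 * (a : ℝ) / 7 + 1 →
      p = n - (2 * t - 2) * (n / (2 * t - 2)) →
        genEx n (Kab a a) (Kab 1 t) =
          ((disjointCopies (n / (2 * t - 2)) (Kab (t - 1) (t - 1))).sum
            (Kab (p / 2) ((p + 1) / 2))).copyCount (Kab a a)) ∧
    -- (iii): `ex(n, K_{a,b}, K_{s,t}) = Ω(n^{3/2 - o(1)})`
    (∀ a b s t : ℕ, 2 ≤ s → s < a → a ≤ b → b < t →
      ∃ ε : ℕ → ℝ, Tendsto ε atTop (𝓝 0) ∧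
        (fun n : ℕ => (n : ℝ) ^ ((3 : ℝ) / 2 - ε n)) =O[atTop]
          (fun n : ℕ => (genEx n (Kab a b) (Kab s t) : ℝ))) := by
  refine ⟨⟨fun a b t n ha hab hbt => genEx_Kab_star_le n ha hab hbt,
    fun a t n ha hat => genEx_Kab_self_star_le n ha hat,
    fun a b t n ha hab hbt hn => genEx_Kab_star_eq_of_dvd ha hab hbt hn⟩,
    fun a t n p ha hat ht hp => ?_, fun a b s t hs hsa hab hbt => ?_⟩
  · exact genEx_Kab_self_star_eq ha hat ht hp
  · exact exists_isBigO_of_pow_le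
      (exists_pow_le_mul_genEx_pow hs (by omega) hab hbt)
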